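/- Consider the typical link of a Poisson bipolar network with ALOHA, Rayleigh fading and Rayleigh distributed link distances. Potential interferers form a homogeneous Poisson point process $\Phi\subset\mathbb{R}^2$ of density $\lambda>0$; each of them is active, independently, with probability $p\in(0,1]$. The receiver is at the origin $o$; the desired transmitter is at $(R,0)$ and is always active. All channel power gains ($h$ for the desired transmitter and $h_z$ for $z\in\Phi$) are exponential with mean $1$, the path loss exponent is $\alpha>2$, and $\delta=2/\alpha$. The link distance $R$ is Rayleigh distributed with mean $1/(2\sqrt{\mu})$, $\mu>0$. The process $\Phi$, the distance $R$, the activity indicators and all the channel gains are independent. Let $$\mathsf{SIR}=\frac{h\,R^{-\alpha}}{\sum_{z\in\Phi} h_z\|z\|^{-\alpha}\mathbf{1}(z\text{ is active})},\qquad P_{\rm s}(\theta)=\mathbb{P}\bigl(\mathsf{SIR}>\theta \mid \Phi, R\bigr),\qquad M_b(\theta)=\mathbb{E}\bigl[P_{\rm s}(\theta)^b\bigr],$$ where $\theta>0$, and for $b\in\mathbb{C}$ let $$D_b(p,\delta)=\sum_{k=1}^{\infty}\binom{b}{k}\binom{\delta-1}{k-1}p^k .$$ Let $b\in\mathbb{C}$,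 and if $p=1$ assume $\Re(b)+\delta>0$. Then the series $D_b(p,\delta)$ and $D_{\Re b}(p,\delta)$ converge absolutely. The moment $M_b(\theta)$ exists (that is, $P_{\rm s}(\theta)^b$ is integrable) if and only if $$\mu+\lambda\theta^{\delta}\Gamma(1+\delta)\Gamma(1-\delta)D_{\Re b}(p,\delta)>0,$$ which holds in particular whenever $\Re b\ge 0$. Whenever the moment exists, the denominator below is nonzero and $$M_b(\theta)=\frac{\mu}{\mu+\lambda\theta^{\delta}\Gamma(1+\delta)\Gamma(1-\delta)D_b(p,\delta)} .$$ -/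

import Mathlib

open MeasureTheory ProbabilityTheory
open scoped ENNReal NNReal

noncomputable section

/-- The Euclidean plane. -/
abbrev Plane : Type := EuclideanSpace ℝ (Fin 2)

/-- The random measure `Φ` on `E` is a Poisson point process with intensity measure `Λ`: the
number of points in a measurable set of finite intensity is Poisson distributed with mean the
intensity of that set, and the numbers of points in disjoint measurable sets are independent. -/
structure IsPoissonPointProcess {Ω E : Type*} [MeasurableSpace Ω] [MeasurableSpace E]
    (Φ : Ω → Measure E) (Λ : Measure E) (P : Measure Ω) : Prop where
  measurable : Measurable Φ
  count_law : ∀ B : Set E, MeasurableSet B → Λ B ≠ ∞ →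
    HasLaw (fun ω => Φ ω B) ((poissonMeasure (Λ B).toNNReal).map (fun k : ℕ => (k : ℝ≥0∞))) P
  count_indep : ∀ (n : ℕ) (B : Fin n → Set E), (∀ i, MeasurableSet (B i)) →
    Pairwise (fun i j => Disjoint (B i) (B j)) → iIndepFun (fun i ω => Φ ω (B i)) P

/-- The Rayleigh distribution with scale `s`: density `(r / s²) exp (-r² / (2 s²))` on `r > 0`. -/
def rayleighMeasure (s : ℝ) : Measure ℝ :=
  (volume.restrict (Set.Ioi 0)).withDensity
    (fun r => ENNReal.ofReal (r / s ^ 2 * Real.exp (-r ^ 2 / (2 * s ^ 2))))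

/-- The point process with points `X 0, X 1, …`, as a random counting measure. -/
def pointProcess {Ω : Type*} (X : ℕ → Ω → Plane) (ω : Ω) : Measure Plane :=
  Measure.sum (fun n => Measure.dirac (X n ω))

/-- Labels of the sources of randomness seen by the typical link: the locations of the
interferers, the length of the link, the fading of the desired signal, and, for the `n`-th
interferer, its medium access decision and its fading. -/
inductive NetworkSource : Type
  | locations
  | linkDistance
  | desiredFading
  | access (n : ℕ)
  | fading (n : ℕ)

/-- The σ-algebra generated by each source of randomness. -/
@[reducible] def NetworkSource.sigma {Ω : Type*} (X : ℕ → Ω → Plane) (R h : Ω → ℝ) (A : ℕ → Ω → Bool)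
    (H : ℕ → Ω → ℝ) : NetworkSource → MeasurableSpace Ω
  | .locations => MeasurableSpace.comap (fun ω n => X n ω) inferInstance
  | .linkDistance => MeasurableSpace.comap R inferInstance
  | .desiredFading => MeasurableSpace.comap h inferInstance
  | .access n => MeasurableSpace.comap (A n) inferInstance
  | .fading n => MeasurableSpace.comap (H n) inferInstance

/-- The typical link of a Poisson bipolar network with ALOHA, Rayleigh fading and Rayleigh
distributed link distances. The potential interferers `X n` form a homogeneous Poisson point
process of density `lam`; interferer `n` is active iff `A n = true`, which has probability `p`, and
has the channel power gain `H n`, exponential with mean `1`. The desired transmitter is at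
`(R, 0)`, is always active and has the channel power gain `h`, exponential with mean `1`; the
receiver is at the origin. The distance `R` is Rayleigh distributed with mean `1 / (2 √mu)`. -/
structure IsTypicalRayleighLink {Ω : Type*} [MeasurableSpace Ω] (P : Measure Ω)
    (lam mu p : ℝ) (X : ℕ → Ω → Plane) (R h : Ω → ℝ) (A : ℕ → Ω → Bool) (H : ℕ → Ω → ℝ) :
    Prop where
  measurable_location : ∀ n, Measurable (X n)
  measurable_linkDistance : Measurable R
  measurable_desiredFading : Measurable h
  measurable_access : ∀ n, Measurable (A n)
  measurable_fading : ∀ n, Measurable (H n)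
  poisson : IsPoissonPointProcess (pointProcess X) (ENNReal.ofReal lam • volume) P
  access_prob : ∀ n, P {ω | A n ω = true} = ENNReal.ofReal p
  fading_law : ∀ n, HasLaw (H n) (expMeasure 1) P
  desiredFading_law : HasLaw h (expMeasure 1) P
  linkDistance_law : ∃ s : ℝ, 0 < s ∧ HasLaw R (rayleighMeasure s) P
  linkDistance_mean : ∫ ω, R ω ∂P = 1 / (2 * Real.sqrt mu)
  indep : iIndep (NetworkSource.sigma X R h A H) P

/-- The interference at the origin: the sum over the active interferers of their channel power
gain times the path loss. -/
def interference {Ω : Type*} (al : ℝ) (X : ℕ → Ω → Plane) (A : ℕ → Ω → Bool) (H : ℕ → Ω → ℝ)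
    (ω : Ω) : ℝ≥0∞ :=
  ∑' n, if A n ω = true then ENNReal.ofReal (H n ω) * ‖X n ω‖ₑ ^ (-al) else 0

/-- The signal-to-interference ratio at the origin, the desired transmitter being at `(R, 0)`. -/
def sir {Ω : Type*} (al : ℝ) (X : ℕ → Ω → Plane) (R h : Ω → ℝ) (A : ℕ → Ω → Bool)
    (H : ℕ → Ω → ℝ) (ω : Ω) : ℝ≥0∞ :=
  ENNReal.ofReal (h ω) * ‖(!₂[R ω, 0] : Plane)‖ₑ ^ (-al) / interference al X A H ω

/-- The σ-algebra generated by the point process of interferers and the link distance. -/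
@[reducible] def networkSigma {Ω : Type*} (X : ℕ → Ω → Plane) (R : Ω → ℝ) : MeasurableSpace Ω :=
  MeasurableSpace.comap (pointProcess X) inferInstance ⊔ MeasurableSpace.comap R inferInstance

/-- The conditional link success probability: the probability of `SIR > θ` given the point process
of interferers and the link distance (so averaged over fading and medium access only). -/
def linkSuccessProb {Ω : Type*} [MeasurableSpace Ω] (P : Measure Ω) (al θ : ℝ)
    (X : ℕ → Ω → Plane) (R h : Ω → ℝ) (A : ℕ → Ω → Bool) (H : ℕ → Ω → ℝ) : Ω → ℝ :=
  P[Set.indicator {ω | ENNReal.ofReal θ < sir al X R h A H ω} (fun _ => (1 : ℝ)) | networkSigma X R]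

/-- The term of index `k + 1` of the series `D_b(p, δ) = ∑_{k ≥ 1} C(b, k) C(δ - 1, k - 1) p ^ k`. -/
def diversityTerm (b : ℂ) (p δ : ℝ) (k : ℕ) : ℂ :=
  Ring.choose b (k + 1) * Ring.choose ((δ : ℂ) - 1) k * (p : ℂ) ^ (k + 1)

/-- `D_b(p, δ) = ∑_{k ≥ 1} C(b, k) C(δ - 1, k - 1) p ^ k`. -/
def diversity (b : ℂ) (p δ : ℝ) : ℂ := ∑' k, diversityTerm b p δ k

end

/-!
Write `Φ` for the process of interferers and `u = 1 / (1 + ‖x‖ ^ al / (θ r ^ al))`. Given the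
interferer locations and the link distance `r`, averaging over the exponential gains and the medium
access decisions turns the success probability into the product over the interferers `x` of
`1 - p u`, that is, into `exp (-∫ w dΦ)` with the loss `w = -log (1 - p u)`
(`IsTypicalRayleighLink.prob_lt_sir`). This product depends on the locations through `Φ` only, so
it is also the conditional probability given `Φ` and the link distance
(`IsTypicalRayleighLink.linkSuccessProb_ae_eq`).

The `b`-th moment at a fixed `r` is therefore a value of the Laplace functional of the Poisson
process, `exp (-lam ∫ (1 - (1 - p u) ^ b) dx)`. For complex `b` this is
`IsPoissonPointProcess.integral_cexp_lintegral`: the identity holds for simple `w` by independence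
of the counts, Fatou's lemma gives a positive exponential moment, and that moment dominates the
passage to the limit. The spatial integral is computed in
`integrable_and_integral_cexp_interfererLoss`: polar coordinates and the substitution by `u` turn
`∫ u ^ (k + 1) dx` into a Beta integral, and the binomial series of `1 - (1 - p u) ^ b`, integrated
termwise, gives `π r ^ 2 θ ^ δ Γ(1 + δ) Γ(1 - δ) D_b(p, δ)`. The termwise integration is justified
by the absolute convergence of the series, which follows from the growth `k ^ (-Re b - 1)` of the
binomial coefficients (`Ring.choose_succ_isBigO`, from Euler's limit for the Gamma function).

Finally `r` is averaged against the Rayleigh density `2 π mu r exp (-π mu r ^ 2)`. The modulus of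
the `b`-th power has the moment with `Re b` in place of `b`, and the resulting Gaussian integral is
finite exactly under the stated inequality; `Re D_b ≥ D_{Re b}`, which compares a moment with
its absolute moment, makes the Gaussian integral for `b` itself converge with a nonzero denominator
(`IsTypicalRayleighLink.moment_totalLoss`).
-/

/-! ### The Laplace functional of a Poisson process -/

section

open Filter Topology

/-- The exponential moments of the Poisson distribution, at complex arguments. -/
lemma integral_cexp_poissonMeasure (r : ℝ≥0) (z : ℂ) :
    ∫ k : ℕ, Complex.exp (z * k) ∂(poissonMeasure r) =
      Complex.exp (r * (Complex.exp z - 1)) := by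
  rw [integral_poissonMeasure]
  have h : HasSum (fun n : ℕ => ((r : ℂ) * Complex.exp z) ^ n / (n.factorial : ℂ))
      (Complex.exp ((r : ℂ) * Complex.exp z)) := by
    rw [Complex.exp_eq_exp_ℂ]
    exact NormedSpace.expSeries_div_hasSum_exp _
  have h2 := h.mul_left (Complex.exp (-(r : ℂ)))
  rw [← Complex.exp_add] at h2
  have h3 : -(r : ℂ) + r * Complex.exp z = r * (Complex.exp z - 1) := by ring
  rw [h3] at h2
  rw [← h2.tsum_eq]
  congr 1
  ext n
  rw [mul_pow, ← Complex.exp_nat_mul, mul_comm (n : ℂ) z]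
  simp only [Complex.real_smul]
  push_cast
  ring

/-- `|e^{zt} - 1| ≤ |z| (e^{ct} - 1) / c`: integrate `|z e^{zs}| ≤ |z| e^{cs}` over `0 ≤ s ≤ t`. -/
lemma norm_cexp_mul_sub_one_le {z : ℂ} {c t : ℝ} (hc : 0 < c) (hz : z.re ≤ c) (ht : 0 ≤ t) :
    ‖Complex.exp (z * t) - 1‖ ≤ ‖z‖ / c * (Real.exp (c * t) - 1) := by
  have h := image_norm_le_of_norm_deriv_right_le_deriv_boundary
    (f := fun s : ℝ => Complex.exp (z * s) - 1)
    (f' := fun s : ℝ => Complex.exp (z * s) * (z * 1)) (a := 0) (b := t)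
    (B := fun s => ‖z‖ / c * (Real.exp (c * s) - 1))
    (B' := fun s => ‖z‖ / c * (Real.exp (c * s) * (c * 1)))
    (by fun_prop) ?_ (by simp) ?_ ?_ (x := t) ⟨ht, le_rfl⟩
  · exact h
  · intro x _
    have : HasDerivAt (fun s : ℝ => Complex.exp (z * s) - 1) (Complex.exp (z * x) * (z * 1)) x := by
      have h1 : HasDerivAt (fun s : ℝ => (s : ℂ)) 1 x := Complex.ofRealCLM.hasDerivAt
      exact ((h1.const_mul z).cexp).sub_const 1
    exact this.hasDerivWithinAt
  · intro x
    exact ((((hasDerivAt_id x).const_mul c).exp).sub_const 1).const_mul _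
  · intro x hx
    rw [norm_mul, Complex.norm_exp, mul_one, mul_one]
    have : ‖z‖ / c * (Real.exp (c * x) * c) = Real.exp (c * x) * ‖z‖ := by
      field_simp
    rw [this]
    gcongr
    simpa using mul_le_mul_of_nonneg_right hz hx.1

/-- Every `[0, ∞]`-valued measurable function is an increasing limit of finite simple functions
supported in sets of finite measure. -/
lemma exists_simpleFunc_seq_finite_support {E : Type*} [MeasurableSpace E]
    (Λ : Measure E) [SigmaFinite Λ] {w : E → ℝ≥0∞}
    (hw : Measurable w) :
    ∃ f : ℕ → SimpleFunc E ℝ≥0∞, (∀ n x, f n x ≠ ∞) ∧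
      (∀ n, Λ (Function.support (f n)) ≠ ∞) ∧ Monotone (fun n x => f n x) ∧
      ∀ x, ⨆ n, f n x = w x := by
  refine ⟨fun n => (SimpleFunc.eapprox w n).restrict (spanningSets Λ n), ?_, ?_, ?_, ?_⟩
  · intro n x
    rw [SimpleFunc.restrict_apply _ (measurableSet_spanningSets Λ n)]
    by_cases hx : x ∈ spanningSets Λ n
    · simpa [hx] using (SimpleFunc.eapprox_lt_top w n x).ne
    · simp [hx]
  · intro n
    refine ne_top_of_le_ne_top (measure_spanningSets_lt_top Λ n).ne (measure_mono fun x hx => ?_)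
    by_contra hx'
    rw [Function.mem_support, SimpleFunc.restrict_apply _ (measurableSet_spanningSets Λ n)] at hx
    simp [hx'] at hx
  · intro m n hmn x
    simp only
    rw [SimpleFunc.restrict_apply _ (measurableSet_spanningSets Λ n),
      SimpleFunc.restrict_apply _ (measurableSet_spanningSets Λ m)]
    by_cases hx : x ∈ spanningSets Λ m
    · simpa [hx, monotone_spanningSets Λ hmn hx] using SimpleFunc.monotone_eapprox w hmn x
    · simp [hx]
  · intro x
    refine le_antisymm (iSup_le fun n => ?_) ?_
    · rw [SimpleFunc.restrict_apply _ (measurableSet_spanningSets Λ n)]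
      refine (Set.indicator_le_self _ _ x).trans ?_
      rw [← SimpleFunc.iSup_eapprox_apply hw x]
      exact le_iSup (fun n => SimpleFunc.eapprox w n x) n
    · rw [← SimpleFunc.iSup_eapprox_apply hw x]
      refine iSup_le fun n => ?_
      have hx : x ∈ ⋃ n, spanningSets Λ n := by simp [iUnion_spanningSets]
      obtain ⟨k, hk⟩ := Set.mem_iUnion.1 hx
      refine le_iSup_of_le (max n k) ?_
      rw [SimpleFunc.restrict_apply _ (measurableSet_spanningSets Λ _)]
      have : x ∈ spanningSets Λ (max n k) := monotone_spanningSets Λ (le_max_right _ _) hk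
      simpa [this] using SimpleFunc.monotone_eapprox w (le_max_left n k) x

namespace IsPoissonPointProcess

variable {Ω E : Type*} [MeasurableSpace Ω] [MeasurableSpace E] {P : Measure Ω}
  {Φ : Ω → Measure E} {Λ : Measure E}

lemma measurable_count (hΦ : IsPoissonPointProcess Φ Λ P) {B : Set E} (hB : MeasurableSet B) :
    Measurable (fun ω => Φ ω B) :=
  (Measure.measurable_coe hB).comp hΦ.measurable

lemma ae_count_ne_top (hΦ : IsPoissonPointProcess Φ Λ P) {B : Set E} (hB : MeasurableSet B)
    (hΛ : Λ B ≠ ∞) : ∀ᵐ ω ∂P, Φ ω B ≠ ∞ := by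
  have hlaw := hΦ.count_law B hB hΛ
  have h : ∀ᵐ x ∂(P.map (fun ω => Φ ω B)), x ≠ ∞ := by
    rw [hlaw.map_eq, ae_map_iff (p := fun x => x ≠ ∞) (by fun_prop)
      (measurableSet_singleton _).compl]
    exact Eventually.of_forall fun k => ENNReal.natCast_ne_top k
  exact ae_of_ae_map hlaw.aemeasurable h

lemma ae_count_eq_zero (hΦ : IsPoissonPointProcess Φ Λ P) {B : Set E} (hB : MeasurableSet B)
    (hΛ : Λ B = 0) : ∀ᵐ ω ∂P, Φ ω B = 0 := by
  have hlaw := hΦ.count_law B hB (by simp [hΛ])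
  have h : ∀ᵐ x ∂(P.map (fun ω => Φ ω B)), x = 0 := by
    rw [hlaw.map_eq, ae_map_iff (p := fun x => x = 0) (by fun_prop)
      (measurableSet_singleton _), hΛ, ae_iff, poissonMeasure,
      Measure.sum_apply _ (MeasurableSet.of_discrete)]
    simp only [Measure.smul_apply, smul_eq_mul, ENNReal.tsum_eq_zero]
    rintro (_ | n) <;> simp
  exact ae_of_ae_map hlaw.aemeasurable h

lemma integral_cexp_count (hΦ : IsPoissonPointProcess Φ Λ P) {B : Set E} (hB : MeasurableSet B)
    (hΛ : Λ B ≠ ∞) (z : ℂ) :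
    ∫ ω, Complex.exp (z * (Φ ω B).toReal) ∂P =
      Complex.exp (Λ.real B * (Complex.exp z - 1)) := by
  have hlaw := hΦ.count_law B hB hΛ
  have h1 : ∫ ω, Complex.exp (z * (Φ ω B).toReal) ∂P =
      ∫ x : ℝ≥0∞, Complex.exp (z * x.toReal) ∂(P.map (fun ω => Φ ω B)) := by
    rw [integral_map hlaw.aemeasurable]
    exact Measurable.aestronglyMeasurable (by fun_prop)
  rw [h1, hlaw.map_eq, integral_map (by fun_prop)
    (Measurable.aestronglyMeasurable (by fun_prop))]
  simp only [ENNReal.toReal_natCast, Complex.ofReal_natCast]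
  exact integral_cexp_poissonMeasure (Λ B).toNNReal z

/-- The Laplace functional of a Poisson process at a complex multiple of a simple function. -/
lemma integral_cexp_lintegral_simpleFunc (hΦ : IsPoissonPointProcess Φ Λ P) (f : SimpleFunc E ℝ≥0∞)
    (hf : ∀ x, f x ≠ ∞) (hΛ : Λ (Function.support f) ≠ ∞) (z : ℂ) :
    ∫ ω, Complex.exp (z * (∫⁻ x, f x ∂(Φ ω)).toReal) ∂P =
      Complex.exp (∫ x, (Complex.exp (z * (f x).toReal) - 1) ∂Λ) := by
  classical
  set s : Finset ℝ≥0∞ := f.range.filter (· ≠ 0) with hs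
  have hBm : ∀ y, MeasurableSet (f ⁻¹' {y}) := fun y => f.measurableSet_fiber y
  have hBΛ : ∀ y ∈ s, Λ (f ⁻¹' {y}) ≠ ∞ := by
    intro y hy
    refine ne_top_of_le_ne_top hΛ (measure_mono fun x hx => ?_)
    simp only [Set.mem_preimage, Set.mem_singleton_iff] at hx
    simpa [hx] using (Finset.mem_filter.1 hy).2
  have hys : ∀ y ∈ s, y ≠ ∞ := by
    intro y hy
    obtain ⟨x, rfl⟩ := SimpleFunc.mem_range.1 (Finset.mem_filter.1 hy).1
    exact hf x
  have hfin : ∀ᵐ ω ∂P, ∀ y ∈ s, Φ ω (f ⁻¹' {y}) ≠ ∞ :=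
    (Finset.eventually_all s).2 fun y hy => hΦ.ae_count_ne_top (hBm y) (hBΛ y hy)
  have hindep : iIndepFun (fun (y : s) ω => Φ ω (f ⁻¹' {(y : ℝ≥0∞)})) P := by
    let e := s.equivFin
    have h := hΦ.count_indep s.card (fun i => f ⁻¹' {((e.symm i : s) : ℝ≥0∞)})
      (fun i => hBm _) (fun i j hij => ?_)
    · have h2 := h.precomp e.injective
      simpa using h2
    · refine Disjoint.preimage _ ?_
      rw [Set.disjoint_singleton]
      exact fun h => hij (e.symm.injective (Subtype.ext h))
  have hpt : ∀ᵐ ω ∂P, Complex.exp (z * (∫⁻ x, f x ∂(Φ ω)).toReal) =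
      ∏ y : s, Complex.exp (z * (y : ℝ≥0∞).toReal * (Φ ω (f ⁻¹' {(y : ℝ≥0∞)})).toReal) := by
    filter_upwards [hfin] with ω hω
    have h1 : ∫⁻ x, f x ∂(Φ ω) = ∑ y ∈ s, y * Φ ω (f ⁻¹' {y}) := by
      rw [SimpleFunc.lintegral_eq_lintegral, SimpleFunc.lintegral, hs, Finset.sum_filter]
      refine Finset.sum_congr rfl fun y _ => ?_
      by_cases hy : y = 0 <;> simp [hy]
    rw [h1, ENNReal.toReal_sum fun y hy => ENNReal.mul_ne_top (hys y hy) (hω y hy),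
      ← Complex.exp_sum, Finset.univ_eq_attach,
      Finset.sum_attach s (fun y => z * y.toReal * (Φ ω (f ⁻¹' {y})).toReal)]
    push_cast
    rw [Finset.mul_sum]
    congr 1
    refine Finset.sum_congr rfl fun y _ => ?_
    rw [ENNReal.toReal_mul]
    push_cast
    ring
  rw [integral_congr_ae hpt, hindep.integral_fun_prod_comp
    (f := fun (y : s) (x : ℝ≥0∞) => Complex.exp (z * (y : ℝ≥0∞).toReal * x.toReal))
    (fun y => (hΦ.measurable_count (hBm _)).aemeasurable)
    (fun y => Measurable.aestronglyMeasurable (by fun_prop))]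
  rw [Finset.prod_congr rfl fun (y : s) _ => hΦ.integral_cexp_count (hBm y) (hBΛ y y.2)
    (z * (y : ℝ≥0∞).toReal), ← Complex.exp_sum, Finset.univ_eq_attach,
    Finset.sum_attach s (fun y => (Λ.real (f ⁻¹' {y}) : ℂ) * (Complex.exp (z * y.toReal) - 1))]
  congr 1
  -- the blocks `f ⁻¹' {y}` are disjoint, and those with `y = 0` contribute nothing
  have hdec : ∀ x, Complex.exp (z * (f x).toReal) - 1 =
      ∑ y ∈ s, (f ⁻¹' {y}).indicator (fun _ => Complex.exp (z * y.toReal) - 1) x := by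
    intro x
    by_cases hx : f x = 0
    · rw [Finset.sum_eq_zero]
      · simp [hx]
      · intro y hy
        have : f x ≠ y := by
          rw [hx]; exact (Finset.mem_filter.1 hy).2.symm
        simp [this]
    · rw [Finset.sum_eq_single (f x)]
      · simp
      · intro y _ hy
        simp [hy.symm]
      · intro h
        exact absurd (Finset.mem_filter.2 ⟨SimpleFunc.mem_range_self f x, hx⟩) h
  simp_rw [hdec]
  rw [integral_finsetSum]
  · refine Finset.sum_congr rfl fun y _ => ?_
    rw [integral_indicator_const _ (hBm y)]
    simp
  · intro y hy
    exact (integrable_indicator_iff (hBm y)).2 (integrableOn_const (hBΛ y hy))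

/-- A positive exponential moment of `∫ w dΦ` is finite as soon as the intensity integral of
`e^{c w} - 1` is: Fatou's lemma along an approximation of `w` by simple functions. In particular
`∫ w dΦ` is almost surely finite. -/
lemma ae_lintegral_ne_top_and_integrable_exp [SigmaFinite Λ] (hΦ : IsPoissonPointProcess Φ Λ P)
    {w : E → ℝ≥0∞} (hw : Measurable w) (hwtop : ∀ x, w x ≠ ∞) {c : ℝ} (hc : 0 < c)
    (hint : Integrable (fun x => Real.exp (c * (w x).toReal) - 1) Λ) :
    (∀ᵐ ω ∂P, ∫⁻ x, w x ∂(Φ ω) ≠ ∞) ∧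
      Integrable (fun ω => Real.exp (c * (∫⁻ x, w x ∂(Φ ω)).toReal)) P := by
  obtain ⟨f, hftop, hfsupp, hfmono, hfsup⟩ := exists_simpleFunc_seq_finite_support Λ hw
  have hfle : ∀ n x, f n x ≤ w x := fun n x => hfsup x ▸ le_iSup (fun n => f n x) n
  have hWm : ∀ g : E → ℝ≥0∞, Measurable g → Measurable (fun ω => ∫⁻ x, g x ∂(Φ ω)) :=
    fun g hg => (Measure.measurable_lintegral hg).comp hΦ.measurable
  have hlim : ∀ ω, Tendsto (fun n => ∫⁻ x, f n x ∂(Φ ω)) atTop (𝓝 (∫⁻ x, w x ∂(Φ ω))) := by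
    intro ω
    refine lintegral_tendsto_of_tendsto_of_monotone (fun n => (f n).measurable.aemeasurable)
      (Eventually.of_forall fun x => fun m n hmn => hfmono hmn x)
      (Eventually.of_forall fun x => ?_)
    rw [← hfsup x]
    exact tendsto_atTop_iSup fun m n hmn => hfmono hmn x
  set K := ∫ x, (Real.exp (c * (w x).toReal) - 1) ∂Λ with hK
  have hbound : ∀ n, ∫⁻ ω, ENNReal.ofReal (Real.exp (c * (∫⁻ x, f n x ∂(Φ ω)).toReal)) ∂P ≤
      ENNReal.ofReal (Real.exp K) := by
    intro n
    have h1 := hΦ.integral_cexp_lintegral_simpleFunc (f n) (hftop n) (hfsupp n) c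
    -- a nonzero Bochner integral has an integrable integrand
    have hi : Integrable (fun ω => Complex.exp ((c : ℂ) * (∫⁻ x, f n x ∂(Φ ω)).toReal)) P := by
      by_contra hcon
      rw [integral_undef hcon] at h1
      exact Complex.exp_ne_zero _ h1.symm
    have hi' : Integrable (fun ω => Real.exp (c * (∫⁻ x, f n x ∂(Φ ω)).toReal)) P := by
      refine hi.norm.congr (Eventually.of_forall fun ω => ?_)
      simp only [Complex.norm_exp]
      norm_cast
    rw [← ofReal_integral_eq_lintegral_ofReal hi' (Eventually.of_forall fun ω => by positivity)]
    refine ENNReal.ofReal_le_ofReal ?_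
    have h2 : ∫ ω, Real.exp (c * (∫⁻ x, f n x ∂(Φ ω)).toReal) ∂P =
        Real.exp (∫ x, (Real.exp (c * (f n x).toReal) - 1) ∂Λ) := by
      have h3 : ∀ ω, Complex.exp ((c : ℂ) * (∫⁻ x, f n x ∂(Φ ω)).toReal) =
        ((Real.exp (c * (∫⁻ x, f n x ∂(Φ ω)).toReal) : ℝ) : ℂ) := by intro ω; push_cast; rfl
      have h4 : ∀ x, Complex.exp ((c : ℂ) * (f n x).toReal) - 1 =
        ((Real.exp (c * (f n x).toReal) - 1 : ℝ) : ℂ) := by intro x; push_cast; rfl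
      simp_rw [h3, h4] at h1
      rw [integral_complex_ofReal, integral_complex_ofReal] at h1
      exact_mod_cast h1
    rw [h2]
    refine Real.exp_le_exp.2 (integral_mono_of_nonneg (Eventually.of_forall fun x => ?_) hint
      (Eventually.of_forall fun x => ?_))
    · simp only [Pi.zero_apply, sub_nonneg, Real.one_le_exp_iff]
      positivity
    · simp only
      gcongr
      · exact hwtop x
      · exact hfle n x
  have hfatou : ∫⁻ ω, liminf (fun n => ENNReal.ofReal
      (Real.exp (c * (∫⁻ x, f n x ∂(Φ ω)).toReal))) atTop ∂P ≤ ENNReal.ofReal (Real.exp K) := by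
    refine (lintegral_liminf_le fun n => ?_).trans ?_
    · have := hWm _ (f n).measurable
      fun_prop
    · exact (liminf_le_liminf (Eventually.of_forall hbound)).trans (by simp)
  have hfin : ∀ᵐ ω ∂P, ∀ n, ∫⁻ x, f n x ∂(Φ ω) ≠ ∞ := by
    refine ae_all_iff.2 fun n => ?_
    filter_upwards [hΦ.ae_count_ne_top (f n).measurableSet_support (hfsupp n)] with ω hω
    rw [SimpleFunc.lintegral_eq_lintegral]
    refine (SimpleFunc.FinMeasSupp.lintegral_lt_top ?_ (Eventually.of_forall (hftop n))).ne
    exact SimpleFunc.finMeasSupp_iff_support.2 hω.lt_top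
  have htop : ∀ᵐ ω ∂P, ∫⁻ x, w x ∂(Φ ω) ≠ ∞ := by
    -- `c t ≤ e^{c t}` bounds the mean of `∫ w dΦ`
    have h1 : ∫⁻ ω, ENNReal.ofReal c * ∫⁻ x, w x ∂(Φ ω) ∂P ≤ ENNReal.ofReal (Real.exp K) := by
      refine le_trans (lintegral_mono_ae ?_) hfatou
      filter_upwards [hfin] with ω hω
      rw [← (ENNReal.Tendsto.const_mul (hlim ω) (Or.inr ENNReal.ofReal_ne_top)).liminf_eq]
      refine liminf_le_liminf (Eventually.of_forall fun n => ?_)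
      rw [← ENNReal.ofReal_toReal (hω n), ← ENNReal.ofReal_mul hc.le]
      refine ENNReal.ofReal_le_ofReal ?_
      rw [ENNReal.toReal_ofReal ENNReal.toReal_nonneg]
      linarith [Real.add_one_le_exp (c * (∫⁻ x, f n x ∂(Φ ω)).toReal)]
    rw [lintegral_const_mul _ (hWm w hw)] at h1
    have h2 : ∫⁻ ω, ∫⁻ x, w x ∂(Φ ω) ∂P ≠ ∞ := by
      intro h
      rw [h, ENNReal.mul_top (by simpa using hc)] at h1
      exact ENNReal.ofReal_ne_top (top_le_iff.1 h1)
    filter_upwards [ae_lt_top (hWm w hw) h2] with ω hω using hω.ne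
  refine ⟨htop, ?_, ?_⟩
  · have := hWm w hw
    exact Measurable.aestronglyMeasurable (by fun_prop)
  · rw [hasFiniteIntegral_iff_ofReal (Eventually.of_forall fun ω => by positivity)]
    refine lt_of_le_of_lt (le_trans (lintegral_mono_ae ?_) hfatou) ENNReal.ofReal_lt_top
    filter_upwards [htop] with ω hω
    have h1 := (ENNReal.tendsto_toReal hω).comp (hlim ω)
    have h2 : Continuous fun t : ℝ => ENNReal.ofReal (Real.exp (c * t)) :=
      ENNReal.continuous_ofReal.comp (by fun_prop)
    exact ((h2.tendsto _).comp h1).liminf_eq.ge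

/-- The Laplace functional of a Poisson process, `E e^{z ∫ w dΦ} = exp (∫ (e^{z w} - 1) dΛ)`,
at any complex `z` with `Re z ≤ c`, provided the intensity integral of `e^{c w} - 1` is finite. -/
theorem integral_cexp_lintegral [SigmaFinite Λ] (hΦ : IsPoissonPointProcess Φ Λ P)
    {w : E → ℝ≥0∞} (hw : Measurable w) (hwtop : ∀ x, w x ≠ ∞) {c : ℝ} (hc : 0 < c)
    (hint : Integrable (fun x => Real.exp (c * (w x).toReal) - 1) Λ) {z : ℂ} (hz : z.re ≤ c) :
    ∫ ω, Complex.exp (z * (∫⁻ x, w x ∂(Φ ω)).toReal) ∂P =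
      Complex.exp (∫ x, (Complex.exp (z * (w x).toReal) - 1) ∂Λ) := by
  obtain ⟨htop, hexp⟩ := hΦ.ae_lintegral_ne_top_and_integrable_exp hw hwtop hc hint
  obtain ⟨f, hftop, hfsupp, hfmono, hfsup⟩ := exists_simpleFunc_seq_finite_support Λ hw
  have hfle : ∀ n x, f n x ≤ w x := fun n x => hfsup x ▸ le_iSup (fun n => f n x) n
  have hflim : ∀ x, Tendsto (fun n => f n x) atTop (𝓝 (w x)) := by
    intro x
    rw [← hfsup x]
    exact tendsto_atTop_iSup fun m n hmn => hfmono hmn x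
  have hlim : ∀ ω, Tendsto (fun n => ∫⁻ x, f n x ∂(Φ ω)) atTop (𝓝 (∫⁻ x, w x ∂(Φ ω))) :=
    fun ω => lintegral_tendsto_of_tendsto_of_monotone (fun n => (f n).measurable.aemeasurable)
      (Eventually.of_forall fun x => fun m n hmn => hfmono hmn x) (Eventually.of_forall hflim)
  have hcont : Continuous fun t : ℝ => Complex.exp (z * t) := by fun_prop
  have h1 : Tendsto (fun n => ∫ ω, Complex.exp (z * (∫⁻ x, f n x ∂(Φ ω)).toReal) ∂P) atTop
      (𝓝 (∫ ω, Complex.exp (z * (∫⁻ x, w x ∂(Φ ω)).toReal) ∂P)) := by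
    refine tendsto_integral_of_dominated_convergence _ (fun n => ?_) hexp (fun n => ?_) ?_
    · have := (Measure.measurable_lintegral (f n).measurable).comp hΦ.measurable
      simp only [Function.comp_def] at this
      exact Measurable.aestronglyMeasurable (by fun_prop)
    · filter_upwards [htop] with ω hω
      rw [Complex.norm_exp]
      refine Real.exp_le_exp.2 ?_
      rw [Complex.re_mul_ofReal]
      have h2 : (∫⁻ x, f n x ∂(Φ ω)).toReal ≤ (∫⁻ x, w x ∂(Φ ω)).toReal :=
        ENNReal.toReal_mono hω (lintegral_mono (hfle n))
      gcongr
    · filter_upwards [htop] with ω hω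
      exact (hcont.tendsto _).comp ((ENNReal.tendsto_toReal hω).comp (hlim ω))
  have h2 : Tendsto (fun n => ∫ x, (Complex.exp (z * (f n x).toReal) - 1) ∂Λ) atTop
      (𝓝 (∫ x, (Complex.exp (z * (w x).toReal) - 1) ∂Λ)) := by
    refine tendsto_integral_of_dominated_convergence
      (fun x => ‖z‖ / c * (Real.exp (c * (w x).toReal) - 1)) (fun n => ?_) (hint.const_mul _)
      (fun n => ?_) ?_
    · have := (f n).measurable
      exact Measurable.aestronglyMeasurable (by fun_prop)
    · refine Eventually.of_forall fun x => ?_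
      refine (norm_cexp_mul_sub_one_le hc hz ENNReal.toReal_nonneg).trans ?_
      have h3 : (f n x).toReal ≤ (w x).toReal := ENNReal.toReal_mono (hwtop x) (hfle n x)
      gcongr
    · refine Eventually.of_forall fun x => ?_
      exact ((hcont.tendsto _).comp ((ENNReal.tendsto_toReal (hwtop x)).comp (hflim x))).sub_const 1
  refine tendsto_nhds_unique h1 (Tendsto.congr (fun n => ?_)
    ((Complex.continuous_exp.tendsto _).comp h2))
  exact (hΦ.integral_cexp_lintegral_simpleFunc (f n) (hftop n) (hfsupp n) z).symm

end IsPoissonPointProcess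

end

/-! ### Binomial coefficients and the series `D_b` -/

section

open Filter Topology

namespace Ring

lemma succ_mul_choose_succ (b : ℂ) (k : ℕ) :
    ((k : ℂ) + 1) * choose b (k + 1) = choose b k * (b - k) := by
  have h := choose_smul_choose b (Nat.le_succ k)
  simpa [Nat.succ_eq_add_one] using h

lemma succ_mul_choose_succ' (b : ℂ) (k : ℕ) :
    ((k : ℂ) + 1) * choose b (k + 1) = b * choose (b - 1) k := by
  have h := choose_smul_choose b (Nat.le_add_left 1 k)
  simpa using h

lemma choose_eq_prod_neg_add (b : ℂ) (n : ℕ) :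
    choose b n = (-1) ^ n * (∏ j ∈ Finset.range n, (-b + j)) / n.factorial := by
  induction n with
  | zero => simp
  | succ n ih =>
    have h : ((n : ℂ) + 1) ≠ 0 := by exact_mod_cast n.succ_ne_zero
    have hn : (n.factorial : ℂ) ≠ 0 := by exact_mod_cast n.factorial_ne_zero
    rw [← mul_right_inj' h, succ_mul_choose_succ, ih, Finset.prod_range_succ,
      Nat.factorial_succ]
    push_cast
    field_simp
    ring

/-- Growth of binomial coefficients, read off from Euler's limit formula for `Γ (-b)`. -/
lemma choose_succ_isBigO (b : ℂ) :
    (fun k : ℕ => choose b (k + 1)) =O[atTop] fun k : ℕ => (k : ℝ) ^ (-b.re - 1) := by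
  by_cases hb : ∃ m : ℕ, b = m
  · -- the coefficients vanish eventually
    obtain ⟨m, rfl⟩ := hb
    refine Asymptotics.IsBigO.of_bound 0 ?_
    filter_upwards [eventually_ge_atTop m] with k hk
    rw [choose_natCast, Nat.choose_eq_zero_of_lt (by omega)]
    simp
  push Not at hb
  have hG : Complex.Gamma (-b) ≠ 0 :=
    Complex.Gamma_ne_zero fun m h => hb m (neg_injective h)
  have hprod : ∀ n, ∏ j ∈ Finset.range n, (-b + (j : ℂ)) ≠ 0 := by
    intro n
    refine Finset.prod_ne_zero_iff.2 fun j _ h => hb j ?_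
    linear_combination -h
  have h1 : (fun k : ℕ => (Complex.GammaSeq (-b) k)⁻¹) =O[atTop] fun _ => (1 : ℝ) :=
    ((Complex.GammaSeq_tendsto_Gamma (-b)).inv₀ hG).isBigO_one ℝ
  have h2 : (fun k : ℕ => (((k : ℝ) ^ (-b.re - 1) : ℝ) : ℂ)) =O[atTop]
      fun k : ℕ => (k : ℝ) ^ (-b.re - 1) :=
    Asymptotics.IsBigO.of_bound 1 (Eventually.of_forall fun k => by simp)
  refine Asymptotics.IsBigO.trans ?_ (by simpa using h1.mul h2)
  refine Asymptotics.IsBigO.of_bound 1 ?_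
  filter_upwards [eventually_gt_atTop 0] with k hk
  have hk' : (0 : ℝ) < k := by exact_mod_cast hk
  have hf : (0 : ℝ) < k.factorial := by exact_mod_cast k.factorial_pos
  have hp : 0 < ‖∏ j ∈ Finset.range (k + 1), (-b + (j : ℂ))‖ := norm_pos_iff.2 (hprod _)
  have hkc : ‖(k : ℂ) ^ (-b)‖ = (k : ℝ) ^ (-b.re) := by
    rw [Complex.norm_natCast_cpow_of_pos hk, Complex.neg_re]
  rw [choose_eq_prod_neg_add, Complex.GammaSeq, one_mul, norm_div, norm_mul, norm_pow, norm_neg,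
    norm_one, one_pow, one_mul, norm_mul, norm_inv, norm_div, norm_mul, hkc,
    Complex.norm_real,
    Complex.norm_natCast, Complex.norm_natCast, Real.norm_of_nonneg (by positivity),
    Real.rpow_sub hk', Real.rpow_one, Nat.factorial_succ]
  have hr : (0 : ℝ) < (k : ℝ) ^ (-b.re) := by positivity
  rw [inv_div]
  push_cast
  rw [div_mul_div_comm, div_le_div_iff₀ (by positivity) (by positivity)]
  nlinarith [mul_pos (mul_pos hp hr) hf]

end Ring

/-- The series that defines `D_b(p, δ)` converges: its terms are of order
`k ^ (-Re b - 1 - δ) * p ^ k`. -/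
lemma summable_diversityTerm {b : ℂ} {p δ : ℝ} (hp : 0 < p) (hp1 : p ≤ 1) (hδ : 0 < δ)
    (hb : p < 1 ∨ 0 < b.re + δ) : Summable (diversityTerm b p δ) := by
  have hδ0 : (δ : ℂ) ≠ 0 := by exact_mod_cast hδ.ne'
  have h1 := Ring.choose_succ_isBigO b
  have h2 : (fun k : ℕ => Ring.choose ((δ : ℂ) - 1) k) =O[atTop]
      fun k : ℕ => (k : ℝ) * (k : ℝ) ^ (-δ - 1) := by
    have h3 : (fun k : ℕ => Ring.choose ((δ : ℂ) - 1) k) =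
        fun k : ℕ => (((k : ℂ) + 1) / δ) * Ring.choose (δ : ℂ) (k + 1) := by
      ext k
      rw [div_mul_eq_mul_div, Ring.succ_mul_choose_succ']
      field_simp
    rw [h3]
    refine Asymptotics.IsBigO.mul ?_ (by simpa using Ring.choose_succ_isBigO (δ : ℂ))
    refine Asymptotics.IsBigO.of_bound (2 / δ) ?_
    filter_upwards [eventually_ge_atTop 1] with k hk
    have hk' : (1 : ℝ) ≤ k := by exact_mod_cast hk
    rw [norm_div, Complex.norm_real, Real.norm_of_nonneg hδ.le,
      Real.norm_of_nonneg (by positivity)]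
    have : ‖(k : ℂ) + 1‖ = (k : ℝ) + 1 := by
      have := Complex.norm_natCast (k + 1)
      push_cast at this
      exact this
    rw [this, div_mul_eq_mul_div]
    gcongr
    linarith
  have h4 : (fun k : ℕ => (p : ℂ) ^ (k + 1)) =O[atTop] fun k : ℕ => p ^ k := by
    refine Asymptotics.IsBigO.of_bound 1 (Eventually.of_forall fun k => ?_)
    rw [norm_pow, Complex.norm_real, Real.norm_of_nonneg hp.le, Real.norm_of_nonneg (by positivity),
      pow_succ, one_mul]
    exact mul_le_of_le_one_right (by positivity) hp1
  have h5 := (h1.mul h2).mul h4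
  rcases hb with hb | hb
  · obtain ⟨m, hm⟩ := exists_nat_ge (-b.re - 1 - δ)
    refine summable_of_isBigO_nat (g := fun k : ℕ => (k : ℝ) ^ m * p ^ k) ?_ (h5.trans ?_)
    · exact summable_pow_mul_geometric_of_norm_lt_one m (by rwa [Real.norm_of_nonneg hp.le])
    · refine Asymptotics.IsBigO.of_bound 1 ?_
      filter_upwards [eventually_ge_atTop 1] with k hk
      have hk' : (1 : ℝ) ≤ k := by exact_mod_cast hk
      have hk0 : (0 : ℝ) < k := by linarith
      rw [Real.norm_of_nonneg (by positivity), Real.norm_of_nonneg (by positivity), one_mul]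
      gcongr
      nth_rewrite 2 [← Real.rpow_one (k : ℝ)]
      rw [← Real.rpow_add hk0, ← Real.rpow_add hk0, ← Real.rpow_natCast]
      exact Real.rpow_le_rpow_of_exponent_le hk' (by linarith)
  · refine summable_of_isBigO_nat (g := fun k : ℕ => (k : ℝ) ^ (-b.re - 1 - δ)) ?_ (h5.trans ?_)
    · exact Real.summable_nat_rpow.2 (by linarith)
    · refine Asymptotics.IsBigO.of_bound 1 ?_
      filter_upwards [eventually_ge_atTop 1] with k hk
      have hk0 : (0 : ℝ) < k := by exact_mod_cast hk
      rw [Real.norm_of_nonneg (by positivity), Real.norm_of_nonneg (by positivity), one_mul]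
      refine (mul_le_of_le_one_right (by positivity) (pow_le_one₀ hp.le hp1)).trans ?_
      nth_rewrite 2 [← Real.rpow_one (k : ℝ)]
      rw [← Real.rpow_add hk0, ← Real.rpow_add hk0]
      refine le_of_eq (congrArg _ ?_)
      ring

/-- `Γ(k + 1 - δ) / k! = (-1) ^ k C(δ - 1, k) Γ(1 - δ)`. -/
lemma Gamma_add_one_sub_div_factorial {δ : ℝ} (hδ1 : δ < 1) (k : ℕ) :
    ((Real.Gamma (k + 1 - δ) / k.factorial : ℝ) : ℂ) =
      (-1) ^ k * Ring.choose ((δ : ℂ) - 1) k * Real.Gamma (1 - δ) := by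
  induction k with
  | zero => simp
  | succ k ih =>
    have hpos : (0 : ℝ) < k + 1 - δ := by
      have : (0 : ℝ) ≤ k := k.cast_nonneg
      linarith
    have h1 : Real.Gamma (((k + 1 : ℕ) : ℝ) + 1 - δ) = (k + 1 - δ) * Real.Gamma (k + 1 - δ) := by
      rw [← Real.Gamma_add_one hpos.ne']
      congr 1
      push_cast
      ring
    have h : ((k : ℂ) + 1) ≠ 0 := by exact_mod_cast k.succ_ne_zero
    have hk : (k.factorial : ℂ) ≠ 0 := by exact_mod_cast k.factorial_ne_zero
    have h2 := Ring.succ_mul_choose_succ ((δ : ℂ) - 1) k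
    rw [h1, ← mul_right_inj' h]
    have h3 : ((k : ℂ) + 1) * ((-1) ^ (k + 1) * Ring.choose ((δ : ℂ) - 1) (k + 1) *
        Real.Gamma (1 - δ)) =
        (-1) ^ (k + 1) * (((k : ℂ) + 1) * Ring.choose ((δ : ℂ) - 1) (k + 1)) *
        Real.Gamma (1 - δ) := by ring
    rw [h3, h2]
    have h4 : (-1 : ℂ) ^ (k + 1) * (Ring.choose ((δ : ℂ) - 1) k * ((δ : ℂ) - 1 - k)) *
        Real.Gamma (1 - δ) = (k + 1 - δ) * ((-1) ^ k * Ring.choose ((δ : ℂ) - 1) k *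
        Real.Gamma (1 - δ)) := by ring
    rw [h4, ← ih, Nat.factorial_succ]
    push_cast
    field_simp

/-- The Beta integral over the open unit interval, with real parameters. -/
lemma integrableOn_beta {u v : ℝ} (hu : 0 < u) (hv : 0 < v) :
    IntegrableOn (fun x : ℝ => x ^ (u - 1) * (1 - x) ^ (v - 1)) (Set.Ioo 0 1) := by
  have h := Complex.betaIntegral_convergent (u := u) (v := v) (by simpa) (by simpa)
  rw [intervalIntegrable_iff_integrableOn_Ioo_of_le zero_le_one] at h
  refine h.re.congr ?_
  filter_upwards [ae_restrict_mem measurableSet_Ioo] with x hx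
  have : ((x : ℂ) ^ ((u : ℂ) - 1) * (1 - (x : ℂ)) ^ ((v : ℂ) - 1)) =
      ((x ^ (u - 1) * (1 - x) ^ (v - 1) : ℝ) : ℂ) := by
    rw [Complex.ofReal_mul, Complex.ofReal_cpow hx.1.le, Complex.ofReal_cpow (by linarith [hx.2])]
    push_cast
    rfl
  rw [this]
  simp only [RCLike.re_to_complex, Complex.ofReal_re]

lemma integral_beta {u v : ℝ} (hu : 0 < u) (hv : 0 < v) :
    ∫ x in Set.Ioo 0 1, x ^ (u - 1) * (1 - x) ^ (v - 1) =
      Real.Gamma u * Real.Gamma v / Real.Gamma (u + v) := by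
  have h := Complex.betaIntegral_eq_Gamma_mul_div u v (by simpa) (by simpa)
  rw [Complex.betaIntegral, intervalIntegral.integral_of_le zero_le_one,
    integral_Ioc_eq_integral_Ioo] at h
  have h2 : ∫ x in Set.Ioo (0 : ℝ) 1, (x : ℂ) ^ ((u : ℂ) - 1) * (1 - (x : ℂ)) ^ ((v : ℂ) - 1) =
      ∫ x in Set.Ioo (0 : ℝ) 1, ((x ^ (u - 1) * (1 - x) ^ (v - 1) : ℝ) : ℂ) := by
    refine setIntegral_congr_fun measurableSet_Ioo fun x hx => ?_
    rw [Complex.ofReal_mul, Complex.ofReal_cpow hx.1.le, Complex.ofReal_cpow (by linarith [hx.2])]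
    push_cast
    rfl
  rw [h2, integral_complex_ofReal, ← Complex.ofReal_add, Complex.Gamma_ofReal, Complex.Gamma_ofReal,
    Complex.Gamma_ofReal] at h
  exact_mod_cast h

/-- A function that is almost everywhere the sum of a series with summable `L¹` norms is
integrable, and its integral is computed termwise. -/
lemma MeasureTheory.integrable_and_hasSum_integral {X : Type*} [MeasurableSpace X] {m : Measure X}
    {F : ℕ → X → ℂ} {f : X → ℂ} (hF : ∀ k, Integrable (F k) m)
    (hsum : Summable fun k => ∫ x, ‖F k x‖ ∂m) (hf : ∀ᵐ x ∂m, HasSum (fun k => F k x) (f x)) :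
    Integrable f m ∧ HasSum (fun k => ∫ x, F k x ∂m) (∫ x, f x ∂m) := by
  have h1 := hasSum_integral_of_summable_integral_norm hF hsum
  have h2 : (fun x => ∑' k, F k x) =ᵐ[m] f := by
    filter_upwards [hf] with x hx using hx.tsum_eq
  refine ⟨⟨?_, ?_⟩, by rwa [integral_congr_ae h2] at h1⟩
  · exact aestronglyMeasurable_of_tendsto_ae atTop
      (f := fun n x => ∑ k ∈ Finset.range n, F k x)
      (fun n => Finset.aestronglyMeasurable_fun_sum _ fun k _ => (hF k).1)
      (by filter_upwards [hf] with x hx using hx.tendsto_sum_nat)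
  · have h3 : ∫⁻ x, ‖f x‖ₑ ∂m ≤ ∫⁻ x, ∑' k, ‖F k x‖ₑ ∂m := by
      refine lintegral_mono_ae ?_
      filter_upwards [hf] with x hx
      refine le_of_tendsto (hx.tendsto_sum_nat.enorm) (Eventually.of_forall fun n => ?_)
      exact (enorm_sum_le _ _).trans (ENNReal.sum_le_tsum _)
    refine lt_of_le_of_lt h3 ?_
    rw [lintegral_tsum fun k => (hF k).1.enorm]
    have h4 : ∀ k, ∫⁻ x, ‖F k x‖ₑ ∂m = ENNReal.ofReal (∫ x, ‖F k x‖ ∂m) := by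
      intro k
      rw [ofReal_integral_eq_lintegral_ofReal (hF k).norm
        (Eventually.of_forall fun x => norm_nonneg _)]
      simp
    simp_rw [h4]
    rw [← ENNReal.ofReal_tsum_of_nonneg (fun k => integral_nonneg fun x => norm_nonneg _) hsum]
    exact ENNReal.ofReal_lt_top

/-- The binomial series without its constant term. -/
lemma hasSum_one_sub_cpow_sub_one (b : ℂ) {x : ℝ} (hx0 : 0 ≤ x) (hx : x < 1) :
    HasSum (fun k : ℕ => (-1) ^ (k + 1) * Ring.choose b (k + 1) * (x : ℂ) ^ (k + 1))
      ((1 - (x : ℂ)) ^ b - 1) := by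
  have hx' : ‖(x : ℂ)‖ₑ < 1 := by
    rw [← ofReal_norm, Complex.norm_real, Real.norm_of_nonneg hx0]
    exact ENNReal.ofReal_lt_one.2 hx
  have h := (Complex.one_add_cpow_hasFPowerSeriesOnBall_zero (a := b)).hasSum (y := -(x : ℂ))
    (by simpa using hx')
  rw [← hasSum_nat_add_iff' 1] at h
  simp only [binomialSeries_apply, List.ofFn_const, List.prod_replicate, smul_eq_mul, zero_add,
    Finset.range_one, Finset.sum_singleton, pow_zero, Ring.choose_zero_right, mul_one] at h
  rw [← sub_eq_add_neg] at h
  convert! h using 2 with k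
  rw [neg_pow]
  ring

end

/-! ### The spatial integral of the interferer loss -/

section

open Filter Topology

/-- The substitution `y = (s (1/u - 1)) ^ (1/al)`, inverse to `u = 1 / (1 + y ^ al / s)`, that takes
`(0, 1)` to `(0, ∞)`. -/
noncomputable def radialSubst (al s u : ℝ) : ℝ := (s * (u⁻¹ - 1)) ^ (al⁻¹)

lemma inv_sub_one_pos {u : ℝ} (hu : u ∈ Set.Ioo (0 : ℝ) 1) : 0 < u⁻¹ - 1 :=
  sub_pos.2 ((one_lt_inv₀ hu.1).2 hu.2)

lemma radialSubst_pos {al s u : ℝ} (hs : 0 < s) (hu : u ∈ Set.Ioo (0 : ℝ) 1) :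
    0 < radialSubst al s u :=
  Real.rpow_pos_of_pos (mul_pos hs (inv_sub_one_pos hu)) _

lemma inv_one_add_radialSubst {al s u : ℝ} (hal : 0 < al) (hs : 0 < s)
    (hu : u ∈ Set.Ioo (0 : ℝ) 1) : (1 + radialSubst al s u ^ al / s)⁻¹ = u := by
  rw [radialSubst, Real.rpow_inv_rpow (mul_pos hs (inv_sub_one_pos hu)).le hal.ne',
    mul_div_cancel_left₀ _ hs.ne']
  simp

lemma radialSubst_image {al s : ℝ} (hal : 0 < al) (hs : 0 < s) :
    radialSubst al s '' Set.Ioo 0 1 = Set.Ioi 0 := by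
  ext y
  constructor
  · rintro ⟨u, hu, rfl⟩
    exact radialSubst_pos hs hu
  · intro hy
    have hy0 : 0 < y := hy
    have h1 : 0 < y ^ al / s := by positivity
    refine ⟨(1 + y ^ al / s)⁻¹, ⟨by positivity, inv_lt_one_of_one_lt₀ (by linarith)⟩, ?_⟩
    rw [radialSubst, inv_inv, add_sub_cancel_left, mul_div_cancel₀ _ hs.ne',
      Real.rpow_rpow_inv hy0.le hal.ne']

lemma radialSubst_hasDerivAt {al s u : ℝ} (hs : 0 < s) (hu : u ∈ Set.Ioo (0 : ℝ) 1) :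
    HasDerivAt (radialSubst al s)
      (s * -(u ^ 2)⁻¹ * al⁻¹ * (s * (u⁻¹ - 1)) ^ (al⁻¹ - 1)) u :=
  (((hasDerivAt_inv hu.1.ne').sub_const 1).const_mul s).rpow_const
    (Or.inl (mul_pos hs (inv_sub_one_pos hu)).ne')

lemma radialSubst_jacobian {al s u δ : ℝ} (hal : 0 < al) (hs : 0 < s) (hδ : δ = 2 / al)
    (hu : u ∈ Set.Ioo (0 : ℝ) 1) :
    |s * -(u ^ 2)⁻¹ * al⁻¹ * (s * (u⁻¹ - 1)) ^ (al⁻¹ - 1)| * radialSubst al s u =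
      δ / 2 * s ^ δ * (u ^ (-δ - 1) * (1 - u) ^ (δ - 1)) := by
  have hv := inv_sub_one_pos hu
  have hu0 := hu.1
  have h1u : 0 < 1 - u := by linarith [hu.2]
  have hneg : s * -(u ^ 2)⁻¹ * al⁻¹ * (s * (u⁻¹ - 1)) ^ (al⁻¹ - 1) =
      -(s * (u ^ 2)⁻¹ * al⁻¹ * (s * (u⁻¹ - 1)) ^ (al⁻¹ - 1)) := by ring
  rw [hneg, abs_neg, abs_of_nonneg (by positivity), radialSubst, mul_assoc,
    ← Real.rpow_add (by positivity)]
  have he : al⁻¹ - 1 + al⁻¹ = δ - 1 := by rw [hδ]; ring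
  have hsub : u⁻¹ - 1 = (1 - u) * u⁻¹ := by field_simp
  rw [he, Real.mul_rpow hs.le hv.le, hsub, Real.mul_rpow h1u.le (by positivity),
    Real.inv_rpow hu0.le, ← Real.rpow_neg hu0.le]
  have h3 : u ^ (-δ - 1) = u ^ (-(δ - 1)) * (u ^ 2)⁻¹ := by
    rw [← Real.rpow_natCast, ← Real.rpow_neg hu0.le, ← Real.rpow_add hu0]
    congr 1
    push_cast
    ring
  have h4 : s ^ δ = s * s ^ (δ - 1) := by
    rw [Real.rpow_sub_one hs.ne']
    field_simp
  have h5 : al⁻¹ = δ / 2 := by rw [hδ]; ring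
  rw [h3, h4, h5]
  ring

lemma radialSubst_injOn {al s : ℝ} (hal : 0 < al) (hs : 0 < s) :
    Set.InjOn (radialSubst al s) (Set.Ioo 0 1) :=
  Set.LeftInvOn.injOn (f₁' := fun y => (1 + y ^ al / s)⁻¹) fun _ hu =>
    inv_one_add_radialSubst hal hs hu

variable {al s δ : ℝ}

lemma radialSubst_integrand (hal : 0 < al) (hs : 0 < s) (hδ : δ = 2 / al) (g : ℝ → ℝ) :
    Set.EqOn (fun u => |s * -(u ^ 2)⁻¹ * al⁻¹ * (s * (u⁻¹ - 1)) ^ (al⁻¹ - 1)| •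
        (radialSubst al s u ^ (2 - 1) • g (1 + radialSubst al s u ^ al / s)⁻¹))
      (fun u => δ / 2 * s ^ δ * (u ^ (-δ - 1) * (1 - u) ^ (δ - 1) * g u)) (Set.Ioo 0 1) := by
  intro u hu
  simp only [smul_eq_mul, Nat.add_one_sub_one, pow_one]
  rw [inv_one_add_radialSubst hal hs hu, ← mul_assoc, radialSubst_jacobian hal hs hδ hu]
  ring

lemma integrable_radial_iff (hal : 0 < al) (hs : 0 < s) (hδ : δ = 2 / al) (g : ℝ → ℝ) :
    Integrable (fun x : Plane => g (1 + ‖x‖ ^ al / s)⁻¹) ↔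
      IntegrableOn (fun u => u ^ (-δ - 1) * (1 - u) ^ (δ - 1) * g u) (Set.Ioo 0 1) := by
  have hδ0 : 0 < δ := hδ ▸ by positivity
  rw [integrable_fun_norm_addHaar volume (f := fun y => g (1 + y ^ al / s)⁻¹),
    finrank_euclideanSpace_fin, ← radialSubst_image hal hs,
    integrableOn_image_iff_integrableOn_abs_deriv_smul measurableSet_Ioo
      (fun u hu => (radialSubst_hasDerivAt hs hu).hasDerivWithinAt) (radialSubst_injOn hal hs),
    integrableOn_congr_fun (radialSubst_integrand hal hs hδ g) measurableSet_Ioo]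
  exact integrable_const_mul_iff (IsUnit.mk0 _ (by positivity)) _

lemma integral_radial (hal : 0 < al) (hs : 0 < s) (hδ : δ = 2 / al) (g : ℝ → ℝ) :
    ∫ x : Plane, g (1 + ‖x‖ ^ al / s)⁻¹ =
      Real.pi * δ * s ^ δ *
        ∫ u in Set.Ioo 0 1, u ^ (-δ - 1) * (1 - u) ^ (δ - 1) * g u := by
  have hvol : (volume : Measure Plane).real (Metric.ball 0 1) = Real.pi := by
    rw [Measure.real, EuclideanSpace.volume_ball_fin_two]
    simp [Real.pi_nonneg]
  rw [integral_fun_norm_addHaar volume (f := fun y => g (1 + y ^ al / s)⁻¹),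
    finrank_euclideanSpace_fin, ← radialSubst_image hal hs,
    integral_image_eq_integral_abs_deriv_smul measurableSet_Ioo
      (fun u hu => (radialSubst_hasDerivAt hs hu).hasDerivWithinAt) (radialSubst_injOn hal hs),
    setIntegral_congr_fun measurableSet_Ioo (radialSubst_integrand hal hs hδ g),
    integral_const_mul, hvol]
  simp only [nsmul_eq_mul, smul_eq_mul]
  push_cast
  ring

lemma radial_pow_integrand (δ : ℝ) (k : ℕ) :
    Set.EqOn (fun u : ℝ => u ^ (-δ - 1) * (1 - u) ^ (δ - 1) * u ^ (k + 1))
      (fun u : ℝ => u ^ ((k : ℝ) + 1 - δ - 1) * (1 - u) ^ (δ - 1)) (Set.Ioo 0 1) := by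
  intro u hu
  have h : u ^ ((k : ℝ) + 1 - δ - 1) = u ^ (-δ - 1) * u ^ (k + 1) := by
    rw [← Real.rpow_natCast, ← Real.rpow_add hu.1]
    congr 1
    push_cast
    ring
  simp only [h]
  ring

lemma integrable_radial_pow (hal : 2 < al) (hs : 0 < s) (hδ : δ = 2 / al) (k : ℕ) :
    Integrable (fun x : Plane => (1 + ‖x‖ ^ al / s)⁻¹ ^ (k + 1)) := by
  have hδ0 : 0 < δ := hδ ▸ by positivity
  have hδ1 : δ < 1 := by rw [hδ, div_lt_one (by linarith)]; exact hal
  have hk : (0 : ℝ) ≤ k := k.cast_nonneg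
  rw [integrable_radial_iff (by linarith) hs hδ (fun u => u ^ (k + 1)),
    integrableOn_congr_fun (radial_pow_integrand δ k) measurableSet_Ioo]
  exact integrableOn_beta (by linarith) hδ0

lemma integral_radial_pow (hal : 2 < al) (hs : 0 < s) (hδ : δ = 2 / al) (k : ℕ) :
    ((∫ x : Plane, (1 + ‖x‖ ^ al / s)⁻¹ ^ (k + 1) : ℝ) : ℂ) =
      (Real.pi * s ^ δ * Real.Gamma (1 + δ) * Real.Gamma (1 - δ) : ℝ) *
        ((-1) ^ k * Ring.choose ((δ : ℂ) - 1) k) := by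
  have hδ0 : 0 < δ := hδ ▸ by positivity
  have hδ1 : δ < 1 := by rw [hδ, div_lt_one (by linarith)]; exact hal
  have hk : (0 : ℝ) ≤ k := k.cast_nonneg
  have h1 := Gamma_add_one_sub_div_factorial hδ1 k
  rw [integral_radial (by linarith) hs hδ (fun u => u ^ (k + 1)),
    setIntegral_congr_fun measurableSet_Ioo (radial_pow_integrand δ k),
    integral_beta (by linarith) hδ0, sub_add_cancel, Real.Gamma_nat_eq_factorial, add_comm 1 δ,
    Real.Gamma_add_one hδ0.ne']
  have h2 : Real.pi * δ * s ^ δ * (Real.Gamma (k + 1 - δ) * Real.Gamma δ / k.factorial) =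
      Real.pi * s ^ δ * (δ * Real.Gamma δ) * (Real.Gamma (k + 1 - δ) / k.factorial) := by ring
  rw [h2, Complex.ofReal_mul, h1]
  push_cast
  ring

/-- The logarithmic loss `-log (1 - p / (1 + ‖x‖ ^ al / s))` that an interferer at `x`, active with
probability `p`, inflicts on the conditional success probability; `s = θ r ^ al` collects the
threshold and the link distance `r`. -/
noncomputable def interfererLoss (al p s : ℝ) (x : Plane) : ℝ≥0∞ :=
  ENNReal.ofReal (-Real.log (1 - p * (1 + ‖x‖ ^ al / s)⁻¹))

lemma interfererLoss_ne_top (al p s : ℝ) (x : Plane) : interfererLoss al p s x ≠ ∞ :=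
  ENNReal.ofReal_ne_top

lemma measurable_interfererLoss (al p s : ℝ) : Measurable (interfererLoss al p s) := by
  unfold interfererLoss
  fun_prop

lemma share_mem_Ioo (hs : 0 < s) {x : Plane} (hx : x ≠ 0) :
    (1 + ‖x‖ ^ al / s)⁻¹ ∈ Set.Ioo (0 : ℝ) 1 := by
  have h : 0 < ‖x‖ ^ al / s := div_pos (Real.rpow_pos_of_pos (norm_pos_iff.2 hx) _) hs
  exact ⟨by positivity, inv_lt_one_of_one_lt₀ (by linarith)⟩

/-- Away from the receiver the thinned share lies strictly between `0` and `1`. -/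
lemma mul_share_mem_Ioo {p : ℝ} (hp : 0 < p) (hp1 : p ≤ 1) (hs : 0 < s) {x : Plane} (hx : x ≠ 0) :
    p * (1 + ‖x‖ ^ al / s)⁻¹ ∈ Set.Ioo (0 : ℝ) 1 := by
  have h := share_mem_Ioo (al := al) hs hx
  exact ⟨mul_pos hp h.1, (mul_le_of_le_one_left h.1.le hp1).trans_lt h.2⟩

lemma toReal_interfererLoss {p : ℝ} (hp : 0 < p) (hp1 : p ≤ 1) (hs : 0 < s) {x : Plane}
    (hx : x ≠ 0) :
    (interfererLoss al p s x).toReal = -Real.log (1 - p * (1 + ‖x‖ ^ al / s)⁻¹) := by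
  have h := mul_share_mem_Ioo (al := al) hp hp1 hs hx
  refine ENNReal.toReal_ofReal (neg_nonneg.2 (Real.log_nonpos ?_ ?_)) <;> linarith [h.1, h.2]

lemma cexp_neg_mul_interfererLoss {p : ℝ} (hp : 0 < p) (hp1 : p ≤ 1) (hs : 0 < s) {x : Plane}
    (hx : x ≠ 0) (b : ℂ) :
    Complex.exp (-b * (interfererLoss al p s x).toReal) =
      (1 - ((p * (1 + ‖x‖ ^ al / s)⁻¹ : ℝ) : ℂ)) ^ b := by
  have h := mul_share_mem_Ioo (al := al) hp hp1 hs hx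
  have h1 : 0 < 1 - p * (1 + ‖x‖ ^ al / s)⁻¹ := by linarith [h.2]
  rw [toReal_interfererLoss hp hp1 hs hx, ← Complex.ofReal_one, ← Complex.ofReal_sub,
    Complex.cpow_def_of_ne_zero (by exact_mod_cast h1.ne'), ← Complex.ofReal_log h1.le]
  congr 1
  push_cast
  ring

/-- The spatial integral behind the moments: expand `(1 - p u) ^ b` in the binomial series, with
`u = 1 / (1 + ‖x‖ ^ al / s)`, and integrate each power of `u` as a Beta integral. -/
theorem integrable_and_integral_cexp_interfererLoss {p : ℝ} (hp : 0 < p) (hp1 : p ≤ 1)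
    (hal : 2 < al) (hs : 0 < s) (hδ : δ = 2 / al) {b : ℂ} (hb : p < 1 ∨ 0 < b.re + δ) :
    Integrable (fun x : Plane => Complex.exp (-b * (interfererLoss al p s x).toReal) - 1) ∧
      ∫ x : Plane, (Complex.exp (-b * (interfererLoss al p s x).toReal) - 1) =
        -((Real.pi * s ^ δ * Real.Gamma (1 + δ) * Real.Gamma (1 - δ) : ℝ) * diversity b p δ) := by
  have hδ0 : 0 < δ := hδ ▸ by positivity
  set κ : ℝ := Real.pi * s ^ δ * Real.Gamma (1 + δ) * Real.Gamma (1 - δ) with hκ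
  have hsum := summable_diversityTerm hp hp1 hδ0 hb
  let F : ℕ → Plane → ℂ := fun k x => ((-1) ^ (k + 1) * Ring.choose b (k + 1) * (p : ℂ) ^ (k + 1)) *
    (((1 + ‖x‖ ^ al / s)⁻¹ ^ (k + 1) : ℝ) : ℂ)
  have hFi : ∀ k, Integrable (F k) := fun k =>
    ((integrable_radial_pow hal hs hδ k).ofReal).const_mul _
  have hFint : ∀ k, ∫ x, F k x = -(κ * diversityTerm b p δ k) := by
    intro k
    simp only [F]
    rw [integral_const_mul, integral_complex_ofReal, integral_radial_pow hal hs hδ k, diversityTerm]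
    have : (-1 : ℂ) ^ (k + 1) * (-1) ^ k = -1 := by
      rw [← pow_add, show k + 1 + k = 2 * k + 1 by ring, pow_succ, pow_mul]
      simp
    linear_combination Ring.choose b (k + 1) * (p : ℂ) ^ (k + 1) * κ *
      Ring.choose ((δ : ℂ) - 1) k * this
  have hFnorm : ∀ k, ∫ x, ‖F k x‖ = ‖∫ x, F k x‖ := by
    intro k
    simp only [F]
    rw [integral_const_mul, integral_complex_ofReal, norm_mul]
    simp_rw [norm_mul]
    rw [integral_const_mul]
    congr 1
    rw [Complex.norm_real, Real.norm_of_nonneg (integral_nonneg fun x => by positivity)]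
    refine integral_congr_ae (Eventually.of_forall fun x => ?_)
    simp only
    rw [Complex.norm_real, Real.norm_of_nonneg (by positivity)]
  have hFsum : Summable fun k => ∫ x, ‖F k x‖ := by
    simp_rw [hFnorm, hFint, norm_neg]
    exact (hsum.mul_left _).norm
  have hlim : ∀ᵐ x : Plane, HasSum (fun k => F k x)
      (Complex.exp (-b * (interfererLoss al p s x).toReal) - 1) := by
    have h0 : ∀ᵐ x : Plane, x ≠ 0 := by simp [ae_iff]
    filter_upwards [h0] with x hx
    have h := mul_share_mem_Ioo (al := al) hp hp1 hs hx
    rw [cexp_neg_mul_interfererLoss hp hp1 hs hx]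
    convert! hasSum_one_sub_cpow_sub_one b h.1.le h.2 using 2 with k
    simp only [F]
    push_cast
    ring
  obtain ⟨h1, h2⟩ := integrable_and_hasSum_integral hFi hFsum hlim
  refine ⟨h1, h2.unique ?_⟩
  simp_rw [hFint]
  exact (hsum.hasSum.mul_left _).neg

end

/-! ### Exponential fading and the signal-to-interference ratio -/

section

open Filter Topology

/-- The map `c ↦ exp (-c)` on `[0, ∞]`, with `exp (-∞) = 0`. -/
noncomputable def expNeg (c : ℝ≥0∞) : ℝ≥0∞ := EReal.exp (-(c : EReal))

@[simp] lemma expNeg_zero : expNeg 0 = 1 := by simp [expNeg]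

@[simp] lemma expNeg_top : expNeg ∞ = 0 := by simp [expNeg]

lemma expNeg_of_ne_top {c : ℝ≥0∞} (hc : c ≠ ∞) :
    expNeg c = ENNReal.ofReal (Real.exp (-c.toReal)) := by
  lift c to ℝ≥0 using hc
  rfl

lemma expNeg_ofReal {t : ℝ} (ht : 0 ≤ t) :
    expNeg (ENNReal.ofReal t) = ENNReal.ofReal (Real.exp (-t)) := by
  rw [expNeg_of_ne_top ENNReal.ofReal_ne_top, ENNReal.toReal_ofReal ht]

lemma expNeg_le_one (c : ℝ≥0∞) : expNeg c ≤ 1 := by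
  simp [expNeg, EReal.coe_ennreal_nonneg]

lemma expNeg_add (c d : ℝ≥0∞) : expNeg (c + d) = expNeg c * expNeg d := by
  have h : ∀ c : ℝ≥0∞, EReal.exp (c : EReal) ≠ 0 := fun c => by simp
  rw [expNeg, expNeg, expNeg, EReal.exp_neg, EReal.exp_neg, EReal.exp_neg, EReal.coe_ennreal_add,
    EReal.exp_add, ENNReal.mul_inv (Or.inl (h c)) (Or.inr (h d))]

lemma expNeg_sum {ι : Type*} (s : Finset ι) (c : ι → ℝ≥0∞) :
    expNeg (∑ i ∈ s, c i) = ∏ i ∈ s, expNeg (c i) := by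
  classical
  induction s using Finset.induction_on with
  | empty => simp
  | insert i s hi ih => rw [Finset.sum_insert hi, Finset.prod_insert hi, expNeg_add, ih]

lemma continuous_expNeg : Continuous expNeg :=
  ENNReal.logOrderIso.symm.continuous.comp (continuous_neg.comp continuous_coe_ennreal_ereal)

@[fun_prop]
lemma measurable_expNeg : Measurable expNeg := continuous_expNeg.measurable

/-- The tail of the standard exponential distribution. -/
lemma expMeasure_one_lt_ofReal (c : ℝ≥0∞) :
    expMeasure 1 {t | c < ENNReal.ofReal t} = expNeg c := by
  have := isProbabilityMeasure_expMeasure one_pos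
  by_cases hc : c = ∞
  · simp [hc]
  have hset : {t : ℝ | c < ENNReal.ofReal t} = (Set.Iic c.toReal)ᶜ := by
    ext t
    simp only [Set.mem_ofPred_eq, Set.mem_compl_iff, Set.mem_Iic, not_le]
    rw [ENNReal.lt_ofReal_iff_toReal_lt hc]
  rw [hset, prob_compl_eq_one_sub measurableSet_Iic, ← ofReal_cdf, cdf_expMeasure_eq one_pos,
    if_pos ENNReal.toReal_nonneg, expNeg_of_ne_top hc, ← ENNReal.ofReal_one,
    ← ENNReal.ofReal_sub _ (by simp [ENNReal.toReal_nonneg])]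
  simp

/-- The Laplace transform of the standard exponential distribution: after an exponential tilt the
density is that of another exponential distribution. -/
lemma lintegral_expNeg_expMeasure {c : ℝ≥0∞} (hc : c ≠ ∞) :
    ∫⁻ t, expNeg (c * ENNReal.ofReal t) ∂(expMeasure 1) = (1 + c)⁻¹ := by
  have hdens : expMeasure 1 = volume.withDensity (exponentialPDF 1) := rfl
  have hm : Measurable (exponentialPDF 1) := (measurable_exponentialPDFReal 1).ennreal_ofReal
  have hpos : 0 < 1 + c.toReal := by positivity
  rw [hdens, lintegral_withDensity_eq_lintegral_mul _ hm (by fun_prop)]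
  have hpt : ∀ t, (exponentialPDF 1 * fun t => expNeg (c * ENNReal.ofReal t)) t =
      (1 + c)⁻¹ * exponentialPDF (1 + c.toReal) t := by
    intro t
    simp only [Pi.mul_apply]
    rw [exponentialPDF_eq, exponentialPDF_eq]
    split_ifs with ht
    · have h1 : c * ENNReal.ofReal t = ENNReal.ofReal (c.toReal * t) := by
        rw [ENNReal.ofReal_mul ENNReal.toReal_nonneg, ENNReal.ofReal_toReal hc]
      have h2 : (1 + c)⁻¹ = ENNReal.ofReal (1 + c.toReal)⁻¹ := by
        rw [ENNReal.ofReal_inv_of_pos hpos, ENNReal.ofReal_add zero_le_one ENNReal.toReal_nonneg,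
          ENNReal.ofReal_one, ENNReal.ofReal_toReal hc]
      rw [h1, expNeg_ofReal (by positivity), h2, ← ENNReal.ofReal_mul (by positivity),
        ← ENNReal.ofReal_mul (by positivity)]
      congr 1
      rw [inv_mul_cancel_left₀ hpos.ne', one_mul, ← Real.exp_add]
      congr 1
      ring
    · simp
  simp_rw [hpt]
  rw [lintegral_const_mul' _ _ (by simp), lintegral_exponentialPDF_eq_one hpos, mul_one]

variable {Ω : Type*} [MeasurableSpace Ω]

lemma measurable_interference {al : ℝ} {X : ℕ → Ω → Plane} {A : ℕ → Ω → Bool} {H : ℕ → Ω → ℝ}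
    (hX : ∀ n, Measurable (X n)) (hA : ∀ n, Measurable (A n)) (hH : ∀ n, Measurable (H n)) :
    Measurable (interference al X A H) := by
  unfold interference
  refine Measurable.tsum fun n => ?_
  refine Measurable.ite (hA n (measurableSet_singleton true)) ?_ measurable_const
  exact (hH n).ennreal_ofReal.mul ((hX n).enorm.pow_const _)

lemma measurable_sir {al : ℝ} {X : ℕ → Ω → Plane} {R h : Ω → ℝ} {A : ℕ → Ω → Bool}
    {H : ℕ → Ω → ℝ} (hX : ∀ n, Measurable (X n)) (hR : Measurable R) (hh : Measurable h)
    (hA : ∀ n, Measurable (A n)) (hH : ∀ n, Measurable (H n)) :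
    Measurable (sir al X R h A H) := by
  unfold sir
  have h1 : Measurable fun ω => (!₂[R ω, 0] : Plane) := by
    refine (WithLp.measurable_toLp 2 (Fin 2 → ℝ)).comp (measurable_pi_iff.2 fun i => ?_)
    fin_cases i <;> simp [hR]
  exact (hh.ennreal_ofReal.mul (h1.enorm.pow_const _)).div (measurable_interference hX hA hH)

lemma enorm_desired_location {r : ℝ} (hr : 0 < r) : ‖(!₂[r, 0] : Plane)‖ₑ = ENNReal.ofReal r := by
  rw [← ofReal_norm, EuclideanSpace.norm_eq]
  simp [Real.sqrt_sq_eq_abs, abs_of_pos hr]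

/-- The signal-to-interference ratio exceeds `θ` iff the gain of the desired signal exceeds
`θ r ^ al` times the interference. -/
lemma lt_sir_iff {Ω : Type*} {al θ r : ℝ} (hθ : 0 < θ) (hr : 0 < r) (X : ℕ → Ω → Plane) (h : Ω → ℝ)
    (A : ℕ → Ω → Bool) (H : ℕ → Ω → ℝ) (ω : Ω) :
    ENNReal.ofReal θ < sir al X (fun _ => r) h A H ω ↔
      ENNReal.ofReal (θ * r ^ al) * interference al X A H ω < ENNReal.ofReal (h ω) := by
  rw [sir, enorm_desired_location hr, ENNReal.ofReal_rpow_of_pos hr]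
  have hr1 : 0 < r ^ (-al) := by positivity
  by_cases hh : ENNReal.ofReal (h ω) = 0
  · simp [hh]
  rw [ENNReal.lt_div_iff_mul_lt (Or.inr ENNReal.ofReal_ne_top)
    (Or.inr (by simpa using hθ)), ← ENNReal.div_lt_iff (Or.inl (by simpa using hr1))
    (Or.inl ENNReal.ofReal_ne_top), mul_comm (ENNReal.ofReal θ), mul_div_assoc,
    ← ENNReal.ofReal_div_of_pos hr1, mul_comm (interference al X A H ω), Real.rpow_neg hr.le,
    div_inv_eq_mul]

/-- The probability that an interferer is inactive, or active but with a fading that lets the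
desired signal through, is the exponential of minus its logarithmic loss. -/
lemma expNeg_interfererLoss {al p s : ℝ} (hp : 0 < p) (hp1 : p ≤ 1) (hs : 0 < s) {x : Plane}
    (hx : x ≠ 0) :
    expNeg (interfererLoss al p s x) =
      (1 - ENNReal.ofReal p) + ENNReal.ofReal p * (1 + ENNReal.ofReal s * ‖x‖ₑ ^ (-al))⁻¹ := by
  have hx0 : 0 < ‖x‖ := norm_pos_iff.2 hx
  have h := mul_share_mem_Ioo (al := al) hp hp1 hs hx
  have hy : 0 < ‖x‖ ^ al := Real.rpow_pos_of_pos hx0 _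
  have h1 : 1 + ENNReal.ofReal s * ‖x‖ₑ ^ (-al) = ENNReal.ofReal (1 + s * (‖x‖ ^ al)⁻¹) := by
    rw [← ofReal_norm, ENNReal.ofReal_rpow_of_pos hx0, Real.rpow_neg hx0.le,
      ENNReal.ofReal_add zero_le_one (by positivity), ENNReal.ofReal_mul hs.le, ENNReal.ofReal_one]
  rw [expNeg_of_ne_top (interfererLoss_ne_top al p s x), toReal_interfererLoss hp hp1 hs hx,
    neg_neg, Real.exp_log (by linarith [h.2]), h1, ← ENNReal.ofReal_inv_of_pos (by positivity),
    ← ENNReal.ofReal_mul hp.le, ← ENNReal.ofReal_one, ← ENNReal.ofReal_sub _ hp.le,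
    ← ENNReal.ofReal_add (by linarith) (by positivity)]
  congr 1
  field_simp
  ring

end

/-! ### The success probability given the locations and the link distance -/

section

open Filter Topology

lemma NetworkSource.sigma_le_iSup {Ω : Type*} (X : ℕ → Ω → Plane) (R h : Ω → ℝ) (A : ℕ → Ω → Bool)
    (H : ℕ → Ω → ℝ) {S : Set NetworkSource} {i : NetworkSource} (hi : i ∈ S) :
    NetworkSource.sigma X R h A H i ≤ ⨆ i ∈ S, NetworkSource.sigma X R h A H i :=
  le_iSup₂ (f := fun i (_ : i ∈ S) => NetworkSource.sigma X R h A H i) i hi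

lemma measurable_access_mul_fading {Ω : Type*} {m : MeasurableSpace Ω} {a : Ω → Bool} {g : Ω → ℝ}
    (ha : Measurable a) (hg : Measurable g) (c : ℝ≥0∞) :
    Measurable fun ω => if a ω = true then ENNReal.ofReal (g ω) * c else 0 :=
  Measurable.ite (ha (measurableSet_singleton true)) (hg.ennreal_ofReal.mul_const c)
    measurable_const

lemma measurable_tsum_access_mul_fading {Ω : Type*} {m : MeasurableSpace Ω} {A : ℕ → Ω → Bool}
    {H : ℕ → Ω → ℝ} (hA : ∀ n, Measurable (A n)) (hH : ∀ n, Measurable (H n)) (c : ℕ → ℝ≥0∞) :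
    Measurable fun ω => ∑' n, if A n ω = true then ENNReal.ofReal (H n ω) * c n else 0 :=
  Measurable.tsum fun n => measurable_access_mul_fading (hA n) (hH n) (c n)

namespace IsTypicalRayleighLink

variable {Ω : Type*} [MeasurableSpace Ω] {P : Measure Ω} {lam mu p : ℝ} {X : ℕ → Ω → Plane}
  {R h : Ω → ℝ} {A : ℕ → Ω → Bool} {H : ℕ → Ω → ℝ}

lemma sigma_le (hnet : IsTypicalRayleighLink P lam mu p X R h A H) (i : NetworkSource) :
    NetworkSource.sigma X R h A H i ≤ (inferInstance : MeasurableSpace Ω) := by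
  cases i with
  | locations => exact (measurable_pi_iff.2 hnet.measurable_location).comap_le
  | linkDistance => exact hnet.measurable_linkDistance.comap_le
  | desiredFading => exact hnet.measurable_desiredFading.comap_le
  | access n => exact (hnet.measurable_access n).comap_le
  | fading n => exact (hnet.measurable_fading n).comap_le

/-- Random variables computed from disjoint sets of sources are independent. -/
lemma indepFun_of_disjoint (hnet : IsTypicalRayleighLink P lam mu p X R h A H)
    {S T : Set NetworkSource} (hST : Disjoint S T) {β γ : Type*} [MeasurableSpace β]
    [MeasurableSpace γ] {U : Ω → β} {V : Ω → γ}
    (hU : Measurable[⨆ i ∈ S, NetworkSource.sigma X R h A H i] U)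
    (hV : Measurable[⨆ i ∈ T, NetworkSource.sigma X R h A H i] V) : IndepFun U V P :=
  (IndepFun_iff_Indep _ _ _).2 <| indep_of_indep_of_le
    (indep_iSup_of_disjoint hnet.sigma_le hnet.indep hST) hU.comap_le hV.comap_le

lemma lintegral_expNeg_access_mul_fading [IsProbabilityMeasure P]
    (hnet : IsTypicalRayleighLink P lam mu p X R h A H) (n : ℕ) {c : ℝ≥0∞} (hc : c ≠ ∞) :
    ∫⁻ ω, expNeg (if A n ω = true then ENNReal.ofReal (H n ω) * c else 0) ∂P =
      (1 - ENNReal.ofReal p) + ENNReal.ofReal p * (1 + c)⁻¹ := by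
  have hAset : MeasurableSet {ω | A n ω = true} :=
    hnet.measurable_access n (measurableSet_singleton true)
  have hind : IndepFun (A n) (H n) P := by
    refine hnet.indepFun_of_disjoint (S := {.access n}) (T := {.fading n}) (by simp) ?_ ?_
    · exact (comap_measurable (A n)).mono
        (NetworkSource.sigma_le_iSup X R h A H (i := .access n) rfl) le_rfl
    · exact (comap_measurable (H n)).mono
        (NetworkSource.sigma_le_iSup X R h A H (i := .fading n) rfl) le_rfl
  have hpt : ∀ ω, expNeg (if A n ω = true then ENNReal.ofReal (H n ω) * c else 0) =
      {ω | A n ω = true}ᶜ.indicator 1 ω +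
        (if A n ω = true then 1 else 0) * expNeg (c * ENNReal.ofReal (H n ω)) := by
    intro ω
    by_cases hω : A n ω = true <;> simp [hω, mul_comm]
  simp_rw [hpt]
  have hmul : ∫⁻ ω, (if A n ω = true then (1 : ℝ≥0∞) else 0) *
      expNeg (c * ENNReal.ofReal (H n ω)) ∂P =
      (∫⁻ ω, (if A n ω = true then (1 : ℝ≥0∞) else 0) ∂P) *
        ∫⁻ ω, expNeg (c * ENNReal.ofReal (H n ω)) ∂P := by
    have h1 : Measurable fun a : Bool => if a = true then (1 : ℝ≥0∞) else 0 := .of_discrete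
    have h2 : Measurable fun t : ℝ => expNeg (c * ENNReal.ofReal t) := by fun_prop
    exact lintegral_mul_eq_lintegral_mul_lintegral_of_indepFun (h1.comp (hnet.measurable_access n))
      (h2.comp (hnet.measurable_fading n)) (hind.comp h1 h2)
  have hind1 : (fun ω => if A n ω = true then (1 : ℝ≥0∞) else 0) =
      {ω | A n ω = true}.indicator 1 := by
    ext ω
    by_cases hω : A n ω = true <;> simp [hω]
  rw [lintegral_add_left (measurable_one.indicator hAset.compl), hmul, hind1,
    lintegral_indicator_one hAset.compl, lintegral_indicator_one hAset, hnet.access_prob,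
    prob_compl_eq_one_sub hAset, hnet.access_prob]
  congr 2
  rw [(hnet.fading_law n).lintegral_comp (f := fun t => expNeg (c * ENNReal.ofReal t))
    (by fun_prop)]
  exact lintegral_expNeg_expMeasure hc

lemma lintegral_expNeg_sum_access_mul_fading [IsProbabilityMeasure P]
    (hnet : IsTypicalRayleighLink P lam mu p X R h A H) {c : ℕ → ℝ≥0∞} (hc : ∀ n, c n ≠ ∞)
    (N : ℕ) :
    ∫⁻ ω, expNeg (∑ n ∈ Finset.range N,
        if A n ω = true then ENNReal.ofReal (H n ω) * c n else 0) ∂P =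
      ∏ n ∈ Finset.range N, ((1 - ENNReal.ofReal p) + ENNReal.ofReal p * (1 + c n)⁻¹) := by
  induction N with
  | zero => simp
  | succ N ih =>
    simp_rw [Finset.sum_range_succ, expNeg_add]
    rw [Finset.prod_range_succ, ← ih, ← hnet.lintegral_expNeg_access_mul_fading N (hc N)]
    let S : Set NetworkSource := {i | ∃ n < N, i = .access n ∨ i = .fading n}
    let T : Set NetworkSource := {.access N, .fading N}
    have hST : Disjoint S T := by
      rw [Set.disjoint_left]
      rintro i ⟨n, hn, rfl | rfl⟩ hi <;> simp [T] at hi <;> omega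
    refine lintegral_mul_eq_lintegral_mul_lintegral_of_independent_measurableSpace
      (iSup₂_le fun i _ => hnet.sigma_le i) (iSup₂_le fun i _ => hnet.sigma_le i)
      (indep_iSup_of_disjoint hnet.sigma_le hnet.indep hST) ?_ ?_
    · refine measurable_expNeg.comp (Finset.measurable_fun_sum _ fun n hn => ?_)
      have hn' := Finset.mem_range.1 hn
      refine measurable_access_mul_fading ?_ ?_ _
      · exact (comap_measurable (A n)).mono
          (NetworkSource.sigma_le_iSup X R h A H (i := .access n) ⟨n, hn', Or.inl rfl⟩) le_rfl
      · exact (comap_measurable (H n)).mono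
          (NetworkSource.sigma_le_iSup X R h A H (i := .fading n) ⟨n, hn', Or.inr rfl⟩) le_rfl
    · refine measurable_expNeg.comp (measurable_access_mul_fading ?_ ?_ _)
      · exact (comap_measurable (A N)).mono
          (NetworkSource.sigma_le_iSup X R h A H (i := .access N) (by simp [T])) le_rfl
      · exact (comap_measurable (H N)).mono
          (NetworkSource.sigma_le_iSup X R h A H (i := .fading N) (by simp [T])) le_rfl

/-- The probability that the gain of the desired signal exceeds a weighted sum of the gains of the
active interferers. -/
lemma prob_tsum_access_mul_fading_lt [IsProbabilityMeasure P]
    (hnet : IsTypicalRayleighLink P lam mu p X R h A H) {c w : ℕ → ℝ≥0∞} (hc : ∀ n, c n ≠ ∞)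
    (hw : ∀ n, expNeg (w n) = (1 - ENNReal.ofReal p) + ENNReal.ofReal p * (1 + c n)⁻¹) :
    P {ω | ∑' n, (if A n ω = true then ENNReal.ofReal (H n ω) * c n else 0) <
      ENNReal.ofReal (h ω)} = expNeg (∑' n, w n) := by
  set V : ℕ → Ω → ℝ≥0∞ := fun n ω => if A n ω = true then ENNReal.ofReal (H n ω) * c n else 0
    with hV
  have hVm : ∀ n, Measurable (V n) := fun n =>
    measurable_access_mul_fading (hnet.measurable_access n) (hnet.measurable_fading n) _
  have hSm : Measurable fun ω => ∑' n, V n ω := Measurable.tsum hVm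
  have hind : IndepFun (fun ω => ∑' n, V n ω) h P := by
    refine hnet.indepFun_of_disjoint (S := {.desiredFading}ᶜ) (T := {.desiredFading})
      disjoint_compl_left ?_ ?_
    · refine measurable_tsum_access_mul_fading (fun n => ?_) (fun n => ?_) c
      · exact (comap_measurable (A n)).mono
          (NetworkSource.sigma_le_iSup X R h A H (i := .access n) (by simp)) le_rfl
      · exact (comap_measurable (H n)).mono
          (NetworkSource.sigma_le_iSup X R h A H (i := .fading n) (by simp)) le_rfl
    · exact (comap_measurable h).mono
        (NetworkSource.sigma_le_iSup X R h A H (i := .desiredFading) rfl) le_rfl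
  have hE : MeasurableSet {q : ℝ≥0∞ × ℝ | q.1 < ENNReal.ofReal q.2} :=
    measurableSet_lt measurable_fst measurable_snd.ennreal_ofReal
  have hprob : P {ω | ∑' n, V n ω < ENNReal.ofReal (h ω)} = ∫⁻ ω, expNeg (∑' n, V n ω) ∂P := by
    have h1 : P {ω | ∑' n, V n ω < ENNReal.ofReal (h ω)} =
        (P.map fun ω => (∑' n, V n ω, h ω)) {q : ℝ≥0∞ × ℝ | q.1 < ENNReal.ofReal q.2} := by
      rw [Measure.map_apply (hSm.prodMk hnet.measurable_desiredFading) hE]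
      rfl
    rw [h1, hind.map_prod_eq_prod_map_map hSm.aemeasurable
      hnet.measurable_desiredFading.aemeasurable, hnet.desiredFading_law.map_eq]
    have := isProbabilityMeasure_expMeasure one_pos
    rw [Measure.prod_apply hE, ← lintegral_map measurable_expNeg hSm]
    exact lintegral_congr fun a => expMeasure_one_lt_ofReal a
  have hlim1 : Tendsto (fun N => ∫⁻ ω, expNeg (∑ n ∈ Finset.range N, V n ω) ∂P) atTop
      (𝓝 (∫⁻ ω, expNeg (∑' n, V n ω) ∂P)) := by
    refine tendsto_lintegral_of_dominated_convergence 1 (fun N => ?_) (fun N => ?_) (by simp) ?_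
    · exact measurable_expNeg.comp (Finset.measurable_fun_sum _ fun n _ => hVm n)
    · exact Eventually.of_forall fun ω => expNeg_le_one _
    · exact Eventually.of_forall fun ω =>
        (continuous_expNeg.tendsto _).comp (ENNReal.tendsto_nat_tsum fun n => V n ω)
  have hlim2 : Tendsto (fun N => expNeg (∑ n ∈ Finset.range N, w n)) atTop
      (𝓝 (expNeg (∑' n, w n))) :=
    (continuous_expNeg.tendsto _).comp (ENNReal.tendsto_nat_tsum w)
  rw [hprob]
  refine tendsto_nhds_unique hlim1 (hlim2.congr fun N => ?_)
  rw [hnet.lintegral_expNeg_sum_access_mul_fading hc N, expNeg_sum]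
  exact Finset.prod_congr rfl fun n _ => hw n

/-- The success probability of a link of deterministic length `r` among interferers at
deterministic locations `x n`. -/
lemma prob_lt_sir [IsProbabilityMeasure P] (hnet : IsTypicalRayleighLink P lam mu p X R h A H)
    (hp : 0 < p) (hp1 : p ≤ 1) {al θ r : ℝ} (hθ : 0 < θ) (hr : 0 < r) {x : ℕ → Plane}
    (hx : ∀ n, x n ≠ 0) :
    P {ω | ENNReal.ofReal θ < sir al (fun n _ => x n) (fun _ => r) h A H ω} =
      expNeg (∑' n, interfererLoss al p (θ * r ^ al) (x n)) := by
  have hs : 0 < θ * r ^ al := by positivity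
  have hfin : ∀ n, ENNReal.ofReal (θ * r ^ al) * ‖x n‖ₑ ^ (-al) ≠ ∞ := by
    intro n
    refine ENNReal.mul_ne_top ENNReal.ofReal_ne_top ?_
    rw [← ofReal_norm, ENNReal.ofReal_rpow_of_pos (norm_pos_iff.2 (hx n))]
    exact ENNReal.ofReal_ne_top
  rw [← hnet.prob_tsum_access_mul_fading_lt hfin
    fun n => expNeg_interfererLoss hp hp1 hs (hx n)]
  congr 1
  ext ω
  rw [Set.mem_ofPred_eq, lt_sir_iff hθ hr, Set.mem_ofPred_eq, interference,
    ← ENNReal.tsum_mul_left]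
  have : ∀ n, (ENNReal.ofReal (θ * r ^ al) *
      if A n ω = true then ENNReal.ofReal (H n ω) * ‖x n‖ₑ ^ (-al) else 0) =
      if A n ω = true then ENNReal.ofReal (H n ω) *
        (ENNReal.ofReal (θ * r ^ al) * ‖x n‖ₑ ^ (-al)) else 0 := by
    intro n
    split_ifs
    · ring
    · simp
  simp_rw [this]

end IsTypicalRayleighLink

end

/-! ### The conditional success probability -/

section

open Filter Topology

variable {Ω : Type*} [MeasurableSpace Ω]

lemma interfererLoss_mono {al p s t : ℝ} (hp : 0 < p) (hp1 : p ≤ 1) (hal : al ≠ 0) (hs : 0 < s)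
    (hst : s ≤ t) (x : Plane) : interfererLoss al p s x ≤ interfererLoss al p t x := by
  by_cases hx : x = 0
  · simp [interfererLoss, hx, Real.zero_rpow hal]
  have ht : 0 < t := hs.trans_le hst
  have h := mul_share_mem_Ioo (al := al) hp hp1 ht hx
  have hy : 0 < ‖x‖ ^ al := Real.rpow_pos_of_pos (norm_pos_iff.2 hx) _
  refine ENNReal.ofReal_le_ofReal (neg_le_neg (Real.log_le_log (by linarith [h.2]) ?_))
  gcongr

lemma continuousAt_interfererLoss {al p s : ℝ} (hp : 0 < p) (hp1 : p ≤ 1) (hal : al ≠ 0)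
    (hs : 0 < s) (x : Plane) : ContinuousAt (fun t => interfererLoss al p t x) s := by
  by_cases hx : x = 0
  · simp only [interfererLoss, hx, norm_zero, Real.zero_rpow hal, zero_div]
    exact continuousAt_const
  have h := mul_share_mem_Ioo (al := al) hp hp1 hs hx
  have hy : 0 < ‖x‖ ^ al := Real.rpow_pos_of_pos (norm_pos_iff.2 hx) _
  have h1 : ContinuousAt (fun t : ℝ => 1 - p * (1 + ‖x‖ ^ al / t)⁻¹) s := by
    refine continuousAt_const.sub (continuousAt_const.mul (ContinuousAt.inv₀ ?_ (by positivity)))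
    exact continuousAt_const.add (continuousAt_const.div continuousAt_id hs.ne')
  exact ENNReal.continuous_ofReal.continuousAt.comp (h1.log (by linarith [h.2])).neg

lemma interfererLoss_eq_iSup {al p s : ℝ} (hp : 0 < p) (hp1 : p ≤ 1) (hal : al ≠ 0) (hs : 0 < s)
    (x : Plane) :
    interfererLoss al p s x =
      ⨆ q : {q : ℚ // 0 < (q : ℝ) ∧ (q : ℝ) < s}, interfererLoss al p (q : ℚ) x := by
  refine le_antisymm (le_of_forall_lt fun a ha => ?_)
    (iSup_le fun q => interfererLoss_mono hp hp1 hal q.2.1 q.2.2.le x)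
  have h1 := (continuousAt_interfererLoss hp hp1 hal hs x).eventually (lt_mem_nhds ha)
  obtain ⟨l, hl, hls⟩ := exists_Ioc_subset_of_mem_nhds h1 ⟨0, hs⟩
  obtain ⟨q, hq1, hq2⟩ := exists_rat_btwn (max_lt hl hs)
  refine lt_iSup_iff.2 ⟨⟨q, (le_max_right _ _).trans_lt hq1, hq2⟩, ?_⟩
  exact hls ⟨(le_max_left _ _).trans_lt hq1, hq2.le⟩

/-- For a random measure `Φ` and a random parameter `s`, the total loss is measurable with respect
to any σ-algebra that makes both `Φ` and `s` measurable. The measures in question need not be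
`s`-finite, so the joint measurability of integrands does not suffice; the loss is monotone and
continuous in the parameter, which reduces the claim to countably many deterministic parameters. -/
lemma exists_measurable_lintegral_interfererLoss {al p : ℝ} (hp : 0 < p) (hp1 : p ≤ 1)
    (hal : al ≠ 0) {Ω : Type*} {m : MeasurableSpace Ω} {Φ : Ω → Measure Plane} {s : Ω → ℝ}
    (hΦ : Measurable Φ) (hs : Measurable s) :
    ∃ W : Ω → ℝ≥0∞, Measurable W ∧
      ∀ ω, 0 < s ω → W ω = ∫⁻ x, interfererLoss al p (s ω) x ∂(Φ ω) := by
  classical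
  refine ⟨fun ω => ⨆ q : ℚ, ⨆ _ : 0 < (q : ℝ) ∧ (q : ℝ) < s ω,
    ∫⁻ x, interfererLoss al p q x ∂(Φ ω), ?_, fun ω hω => ?_⟩
  · refine Measurable.iSup fun q => ?_
    simp_rw [iSup_eq_if]
    refine Measurable.ite ?_ ?_ measurable_const
    · exact (MeasurableSet.const _).inter (measurableSet_lt measurable_const hs)
    · exact (Measure.measurable_lintegral (measurable_interfererLoss al p q)).comp hΦ
  · simp_rw [interfererLoss_eq_iSup hp hp1 hal hω]
    rw [lintegral_iSup_directed (fun q => (measurable_interfererLoss al p _).aemeasurable),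
      iSup_subtype]
    refine Monotone.directed_le fun q q' hqq' x => ?_
    exact interfererLoss_mono hp hp1 hal q.2.1 (by exact_mod_cast hqq') x

lemma lintegral_pointProcess {Ω : Type*} {X : ℕ → Ω → Plane} {f : Plane → ℝ≥0∞} (hf : Measurable f)
    (ω : Ω) :
    ∫⁻ x, f x ∂(pointProcess X ω) = ∑' n, f (X n ω) := by
  simp [pointProcess, lintegral_sum_measure, lintegral_dirac' _ hf]

lemma measurable_pointProcess {X : ℕ → Ω → Plane} (hX : ∀ n, Measurable (X n)) :
    Measurable (pointProcess X) := by
  refine Measure.measurable_of_measurable_coe _ fun s hs => ?_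
  simp only [pointProcess, Measure.sum_apply _ hs]
  exact Measurable.tsum fun n =>
    (Measure.measurable_coe hs).comp (Measure.measurable_dirac.comp (hX n))

/-- Minus the logarithm of the conditional success probability: the total loss inflicted by the
potential interferers. -/
noncomputable def totalLoss (al p θ : ℝ) (X : ℕ → Ω → Plane) (R : Ω → ℝ) (ω : Ω) : ℝ≥0∞ :=
  ∑' n, interfererLoss al p (θ * R ω ^ al) (X n ω)

lemma Measurable.interfererLoss (al p : ℝ) {s : Ω → ℝ} {x : Ω → Plane} (hs : Measurable s)
    (hx : Measurable x) : Measurable fun ω => interfererLoss al p (s ω) (x ω) := by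
  unfold _root_.interfererLoss
  fun_prop

lemma measurable_totalLoss (al p θ : ℝ) {X : ℕ → Ω → Plane} {R : Ω → ℝ} (hX : ∀ n, Measurable (X n))
    (hR : Measurable R) : Measurable (totalLoss al p θ X R) :=
  Measurable.tsum fun n => .interfererLoss al p ((hR.pow_const al).const_mul θ) (hX n)

lemma ae_rayleighMeasure_pos (s : ℝ) : ∀ᵐ r ∂(rayleighMeasure s), 0 < r :=
  (withDensity_absolutelyContinuous _ _).ae_le (ae_restrict_mem measurableSet_Ioi)

lemma measurable_sequence {Ω β : Type*} {m : MeasurableSpace Ω} [MeasurableSpace β] {f : ℕ → Ω → β}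
    (hf : ∀ n, Measurable (f n)) : Measurable fun ω n => f n ω :=
  measurable_pi_iff.2 hf

namespace IsTypicalRayleighLink

variable {P : Measure Ω} {lam mu p : ℝ} {X : ℕ → Ω → Plane}
  {R h : Ω → ℝ} {A : ℕ → Ω → Bool} {H : ℕ → Ω → ℝ}

lemma ae_linkDistance_pos (hnet : IsTypicalRayleighLink P lam mu p X R h A H) :
    ∀ᵐ ω ∂P, 0 < R ω := by
  obtain ⟨s, -, hs⟩ := hnet.linkDistance_law
  refine ae_of_ae_map hs.aemeasurable (p := fun r => 0 < r) ?_
  rw [hs.map_eq]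
  exact ae_rayleighMeasure_pos s

lemma ae_location_ne_zero (hnet : IsTypicalRayleighLink P lam mu p X R h A H) :
    ∀ᵐ ω ∂P, ∀ n, X n ω ≠ 0 := by
  filter_upwards [hnet.poisson.ae_count_eq_zero (measurableSet_singleton (0 : Plane)) (by simp)]
    with ω hω n hn
  rw [pointProcess, Measure.sum_apply _ (measurableSet_singleton _), ENNReal.tsum_eq_zero] at hω
  simpa [hn] using hω n

/-- Averaging over the fading and the medium access, which are independent of the interferer
locations and the link distance. -/
lemma prob_inter_lt_sir [IsProbabilityMeasure P] (hnet : IsTypicalRayleighLink P lam mu p X R h A H)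
    (hp : 0 < p) (hp1 : p ≤ 1) {al θ : ℝ} (hθ : 0 < θ) {B : Set ((ℕ → Plane) × ℝ)}
    (hB : MeasurableSet B) :
    P ((fun ω => ((fun n => X n ω), R ω)) ⁻¹' B ∩ {ω | ENNReal.ofReal θ < sir al X R h A H ω}) =
      ∫⁻ ω in (fun ω => ((fun n => X n ω), R ω)) ⁻¹' B, expNeg (totalLoss al p θ X R ω) ∂P := by
  set U : Ω → (ℕ → Plane) × ℝ := fun ω => ((fun n => X n ω), R ω) with hU
  set V : Ω → ℝ × (ℕ → Bool) × (ℕ → ℝ) := fun ω => (h ω, (fun n => A n ω), fun n => H n ω) with hV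
  have hUm : Measurable U :=
    (measurable_pi_iff.2 hnet.measurable_location).prodMk hnet.measurable_linkDistance
  have hVm : Measurable V := hnet.measurable_desiredFading.prodMk
    ((measurable_pi_iff.2 hnet.measurable_access).prodMk
      (measurable_pi_iff.2 hnet.measurable_fading))
  have hind : IndepFun U V P := by
    let S : Set NetworkSource := {.locations, .linkDistance}
    refine hnet.indepFun_of_disjoint (S := S) (T := Sᶜ) disjoint_compl_right ?_ ?_
    · refine Measurable.prodMk ?_ ?_
      · exact (comap_measurable (fun ω n => X n ω)).mono
          (NetworkSource.sigma_le_iSup X R h A H (i := .locations) (by simp [S])) le_rfl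
      · exact (comap_measurable R).mono
          (NetworkSource.sigma_le_iSup X R h A H (i := .linkDistance) (by simp [S])) le_rfl
    · refine Measurable.prodMk ?_ (Measurable.prodMk ?_ ?_)
      · exact (comap_measurable h).mono
          (NetworkSource.sigma_le_iSup X R h A H (i := .desiredFading) (by simp [S])) le_rfl
      · refine measurable_sequence fun n => ?_
        exact (comap_measurable (A n)).mono
          (NetworkSource.sigma_le_iSup X R h A H (i := .access n) (by simp [S])) le_rfl
      · refine measurable_sequence fun n => ?_
        exact (comap_measurable (H n)).mono
          (NetworkSource.sigma_le_iSup X R h A H (i := .fading n) (by simp [S])) le_rfl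
  -- the ratio as a function on the canonical space of all sources of randomness
  let F : ((ℕ → Plane) × ℝ) × (ℝ × (ℕ → Bool) × (ℕ → ℝ)) → ℝ≥0∞ :=
    sir al (fun n q => q.1.1 n) (fun q => q.1.2) (fun q => q.2.1) (fun n q => q.2.2.1 n)
      (fun n q => q.2.2.2 n)
  have hF : Measurable F := by
    refine measurable_sir (fun n => ?_) ?_ ?_ (fun n => ?_) (fun n => ?_) <;> fun_prop
  let L : (ℕ → Plane) × ℝ → ℝ≥0∞ := totalLoss al p θ (fun n u => u.1 n) (fun u => u.2)
  have hL : Measurable L := by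
    refine measurable_totalLoss al p θ (fun n => ?_) ?_ <;> fun_prop
  have hE : MeasurableSet (Prod.fst ⁻¹' B ∩ {q | ENNReal.ofReal θ < F q}) :=
    (measurable_fst hB).inter (measurableSet_lt measurable_const hF)
  have h1 : P (U ⁻¹' B ∩ {ω | ENNReal.ofReal θ < sir al X R h A H ω}) =
      (P.map fun ω => (U ω, V ω)) (Prod.fst ⁻¹' B ∩ {q | ENNReal.ofReal θ < F q}) := by
    rw [Measure.map_apply (hUm.prodMk hVm) hE]
    rfl
  rw [h1, hind.map_prod_eq_prod_map_map hUm.aemeasurable hVm.aemeasurable, Measure.prod_apply hE,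
    lintegral_map (measurable_measure_prodMk_left hE) hUm, ← lintegral_indicator (hUm hB)]
  refine lintegral_congr_ae ?_
  filter_upwards [hnet.ae_linkDistance_pos, hnet.ae_location_ne_zero] with ω hR hX
  rw [Measure.map_apply hVm (measurable_prodMk_left hE)]
  by_cases hω : U ω ∈ B
  · rw [Set.indicator_of_mem (show ω ∈ U ⁻¹' B from hω)]
    have h2 := hnet.prob_lt_sir hp hp1 (al := al) hθ hR (x := fun n => X n ω) hX
    rw [totalLoss, ← h2]
    congr 1
    ext ω'
    simp [hω, F, sir, interference, U, V]
  · rw [Set.indicator_of_notMem (show ω ∉ U ⁻¹' B from hω)]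
    convert! measure_empty (μ := P)
    ext ω'
    simp [hω]

lemma networkSigma_le (hnet : IsTypicalRayleighLink P lam mu p X R h A H) :
    networkSigma X R ≤ (inferInstance : MeasurableSpace Ω) :=
  sup_le (measurable_pointProcess hnet.measurable_location).comap_le
    hnet.measurable_linkDistance.comap_le

/-- The conditional success probability is the exponential of minus the total loss. -/
theorem linkSuccessProb_ae_eq [IsProbabilityMeasure P]
    (hnet : IsTypicalRayleighLink P lam mu p X R h A H) (hp : 0 < p) (hp1 : p ≤ 1) {al θ : ℝ}
    (hal : al ≠ 0) (hθ : 0 < θ) :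
    linkSuccessProb P al θ X R h A H =ᵐ[P] fun ω => (expNeg (totalLoss al p θ X R ω)).toReal := by
  have hle := hnet.networkSigma_le
  have hLm := measurable_totalLoss al p θ hnet.measurable_location hnet.measurable_linkDistance
  have hem : Measurable fun ω => expNeg (totalLoss al p θ X R ω) := measurable_expNeg.comp hLm
  have hEm : MeasurableSet {ω | ENNReal.ofReal θ < sir al X R h A H ω} :=
    measurableSet_lt measurable_const (measurable_sir hnet.measurable_location
      hnet.measurable_linkDistance hnet.measurable_desiredFading hnet.measurable_access
      hnet.measurable_fading)
  have hint : Integrable (fun ω => (expNeg (totalLoss al p θ X R ω)).toReal) P := by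
    refine Integrable.of_bound hem.ennreal_toReal.aestronglyMeasurable 1
      (Eventually.of_forall fun ω => ?_)
    rw [Real.norm_of_nonneg ENNReal.toReal_nonneg]
    exact ENNReal.toReal_le_of_le_ofReal zero_le_one (by simpa using expNeg_le_one _)
  symm
  refine ae_eq_condExp_of_forall_setIntegral_eq hle ?_ (fun s _ _ => hint.integrableOn) ?_ ?_
  · exact (integrable_const (1 : ℝ)).indicator hEm
  · intro s hs _
    have hs' : MeasurableSet[MeasurableSpace.comap (fun ω => ((fun n => X n ω), R ω))
        inferInstance] s := by
      refine (sup_le ?_ ?_ : networkSigma X R ≤ _) s hs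
      · have : pointProcess X = pointProcess (fun n (u : (ℕ → Plane) × ℝ) => u.1 n) ∘
            fun ω => ((fun n => X n ω), R ω) := rfl
        rw [this, ← MeasurableSpace.comap_comp]
        exact MeasurableSpace.comap_mono (measurable_pointProcess fun n => by fun_prop).comap_le
      · have : R = Prod.snd ∘ fun ω => ((fun n => X n ω), R ω) := rfl
        rw [this, ← MeasurableSpace.comap_comp]
        exact MeasurableSpace.comap_mono measurable_snd.comap_le
    obtain ⟨B, hB, rfl⟩ := hs'
    have hsm := hle _ hs
    have h1 := hnet.prob_inter_lt_sir hp hp1 (al := al) hθ hB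
    rw [integral_toReal hem.aemeasurable (Eventually.of_forall fun ω =>
      (expNeg_le_one _).trans_lt ENNReal.one_lt_top), ← h1, setIntegral_indicator hEm]
    simp [Measure.real]
  · obtain ⟨W, hW, hWeq⟩ := exists_measurable_lintegral_interfererLoss (m := networkSigma X R)
      hp hp1 hal (Φ := pointProcess X) (s := fun ω => θ * R ω ^ al)
      ((comap_measurable _).mono le_sup_left le_rfl)
      ((((comap_measurable R).mono le_sup_right le_rfl).pow_const al).const_mul θ)
    refine ⟨fun ω => (expNeg (W ω)).toReal,
      (measurable_expNeg.comp hW).ennreal_toReal.stronglyMeasurable, ?_⟩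
    filter_upwards [hnet.ae_linkDistance_pos] with ω hω
    rw [hWeq ω (by positivity), lintegral_pointProcess (measurable_interfererLoss _ _ _)]
    rfl

end IsTypicalRayleighLink

end

/-! ### The Rayleigh distribution -/

section

open Filter Topology

section Rayleigh

variable {s : ℝ}

lemma rayleighMeasure_eq (hs : 0 < s) :
    rayleighMeasure s = (volume.restrict (Set.Ioi 0)).withDensity fun r =>
      ENNReal.ofReal (2 * (2 * s ^ 2)⁻¹ * (r * Real.exp (-(2 * s ^ 2)⁻¹ * r ^ 2))) := by
  unfold rayleighMeasure
  congr 1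
  ext r
  congr 1
  rw [show -r ^ 2 / (2 * s ^ 2) = -(2 * s ^ 2)⁻¹ * r ^ 2 by ring]
  field_simp

variable {E : Type*} [NormedAddCommGroup E] [NormedSpace ℝ E]

lemma toReal_rayleigh_density {a r : ℝ} (ha : 0 < a) (hr : 0 < r) :
    (ENNReal.ofReal (2 * a * (r * Real.exp (-a * r ^ 2)))).toReal =
      2 * a * (r * Real.exp (-a * r ^ 2)) :=
  ENNReal.toReal_ofReal (by positivity)

lemma integrable_rayleighMeasure_iff (hs : 0 < s) (f : ℝ → E) :
    Integrable f (rayleighMeasure s) ↔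
      IntegrableOn (fun r => (2 * (2 * s ^ 2)⁻¹ * (r * Real.exp (-(2 * s ^ 2)⁻¹ * r ^ 2))) • f r)
        (Set.Ioi 0) := by
  rw [rayleighMeasure_eq hs, integrable_withDensity_iff_integrable_smul' (by fun_prop)
    (Eventually.of_forall fun r => ENNReal.ofReal_lt_top)]
  refine integrableOn_congr_fun (fun r hr => ?_) measurableSet_Ioi
  rw [toReal_rayleigh_density (by positivity) hr]

lemma integral_rayleighMeasure (hs : 0 < s) (f : ℝ → E) :
    ∫ r, f r ∂(rayleighMeasure s) =
      ∫ r in Set.Ioi 0, (2 * (2 * s ^ 2)⁻¹ * (r * Real.exp (-(2 * s ^ 2)⁻¹ * r ^ 2))) • f r := by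
  rw [rayleighMeasure_eq hs, integral_withDensity_eq_integral_toReal_smul (by fun_prop)
    (Eventually.of_forall fun r => ENNReal.ofReal_lt_top)]
  refine setIntegral_congr_fun measurableSet_Ioi fun r hr => ?_
  rw [toReal_rayleigh_density (by positivity) hr]

/-- The mean of a Rayleigh distribution determines its scale. -/
lemma inv_two_mul_sq_of_mean (hs : 0 < s) {mu : ℝ} (hmu : 0 < mu)
    (hmean : ∫ r, r ∂(rayleighMeasure s) = 1 / (2 * Real.sqrt mu)) :
    (2 * s ^ 2)⁻¹ = Real.pi * mu := by
  set a := (2 * s ^ 2)⁻¹ with ha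
  have ha0 : 0 < a := by positivity
  have h1 := _root_.integral_rpow_mul_exp_neg_mul_rpow (p := 2) (q := 2) (b := a) (by norm_num)
    (by norm_num) ha0
  have h2 : ∫ r in Set.Ioi 0, (2 * a * (r * Real.exp (-a * r ^ 2))) • r =
      2 * a * ∫ r in Set.Ioi (0 : ℝ), r ^ (2 : ℝ) * Real.exp (-a * r ^ (2 : ℝ)) := by
    rw [← integral_const_mul]
    refine setIntegral_congr_fun measurableSet_Ioi fun r _ => ?_
    simp only [smul_eq_mul, Real.rpow_two]
    ring
  rw [integral_rayleighMeasure hs, h2, h1] at hmean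
  have hG : Real.Gamma ((2 + 1) / 2) = Real.sqrt Real.pi / 2 := by
    rw [show ((2 : ℝ) + 1) / 2 = 1 / 2 + 1 by norm_num, Real.Gamma_add_one (by norm_num),
      Real.Gamma_one_half_eq]
    ring
  have hpow : a ^ (-((2 : ℝ) + 1) / 2) = (a * Real.sqrt a)⁻¹ := by
    rw [show -((2 : ℝ) + 1) / 2 = -(1 + 1 / 2) by norm_num, Real.rpow_neg ha0.le,
      Real.rpow_add ha0, Real.rpow_one, Real.sqrt_eq_rpow]
  rw [hG, hpow] at hmean
  have hsa : 0 < Real.sqrt a := Real.sqrt_pos.2 ha0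
  have hsm : 0 < Real.sqrt mu := Real.sqrt_pos.2 hmu
  have h3 : Real.sqrt Real.pi * Real.sqrt mu = Real.sqrt a := by
    field_simp at hmean
    linarith
  rw [← Real.sq_sqrt ha0.le, ← h3, mul_pow, Real.sq_sqrt Real.pi_pos.le, Real.sq_sqrt hmu.le]

lemma integrable_exp_neg_mul_sq_rayleighMeasure_iff (hs : 0 < s) (t : ℝ) :
    Integrable (fun r => Real.exp (-t * r ^ 2)) (rayleighMeasure s) ↔ 0 < (2 * s ^ 2)⁻¹ + t := by
  have h0 : 0 < (2 * s ^ 2)⁻¹ := by positivity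
  set a := (2 * s ^ 2)⁻¹ with ha
  have h1 : ∀ r : ℝ, (2 * a * (r * Real.exp (-a * r ^ 2))) • Real.exp (-t * r ^ 2) =
      2 * a * (r * Real.exp (-(a + t) * r ^ 2)) := by
    intro r
    rw [neg_add, add_mul, Real.exp_add, smul_eq_mul]
    ring
  rw [integrable_rayleighMeasure_iff hs]
  simp_rw [← ha, h1]
  constructor
  · intro h
    by_contra hneg
    -- the integrand is at least `2 a r` on `(0, ∞)`
    have h2 : IntegrableOn (fun _ : ℝ => 2 * a) (Set.Ioi 1) := by
      refine Integrable.mono' (h.mono_set (Set.Ioi_subset_Ioi zero_le_one))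
        aestronglyMeasurable_const ?_
      filter_upwards [ae_restrict_mem measurableSet_Ioi] with r hr
      have hr1 : (1 : ℝ) < r := hr
      rw [Real.norm_of_nonneg (by positivity)]
      have h3 : 1 ≤ Real.exp (-(a + t) * r ^ 2) :=
        Real.one_le_exp (mul_nonneg (by linarith) (by positivity))
      have h4 : 1 ≤ r * Real.exp (-(a + t) * r ^ 2) := by nlinarith
      nlinarith
    rw [integrableOn_const_iff] at h2
    simp [h0.ne'] at h2
  · intro h
    exact ((integrable_mul_exp_neg_mul_sq h).integrableOn).const_mul _

lemma integral_cexp_neg_mul_sq_rayleighMeasure (hs : 0 < s) {z : ℂ}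
    (hz : 0 < (2 * s ^ 2)⁻¹ + z.re) :
    ∫ r, Complex.exp (-z * (r : ℂ) ^ 2) ∂(rayleighMeasure s) =
      (((2 * s ^ 2)⁻¹ : ℝ) : ℂ) / (((2 * s ^ 2)⁻¹ : ℝ) + z) := by
  rw [integral_rayleighMeasure hs]
  set a := (2 * s ^ 2)⁻¹ with ha
  have h1 : ∀ r : ℝ, (2 * a * (r * Real.exp (-a * r ^ 2))) • Complex.exp (-z * (r : ℂ) ^ 2) =
      2 * a * (r * Complex.exp (-(a + z) * (r : ℂ) ^ 2)) := by
    intro r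
    rw [Complex.real_smul]
    push_cast
    rw [neg_add, add_mul, Complex.exp_add]
    ring
  have hz' : 0 < ((a : ℂ) + z).re := by simpa using hz
  have hne : (a : ℂ) + z ≠ 0 := fun h => by simp [h] at hz'
  simp_rw [h1]
  rw [integral_const_mul, integral_mul_cexp_neg_mul_sq hz']
  field_simp

end Rayleigh

end

/-! ### The moments -/

section

open Filter Topology

/-- The factor `lam θ ^ δ Γ(1 + δ) Γ(1 - δ)` that multiplies `D_b` in the exponent of the moments of
a link of deterministic length. -/
noncomputable def interferenceRate (lam θ δ : ℝ) : ℝ :=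
  lam * θ ^ δ * Real.Gamma (1 + δ) * Real.Gamma (1 - δ)

lemma interferenceRate_pos {lam θ δ : ℝ} (hlam : 0 < lam) (hθ : 0 < θ) (hδ0 : 0 < δ) (hδ1 : δ < 1) :
    0 < interferenceRate lam θ δ := by
  have h1 := Real.Gamma_pos_of_pos (show 0 < 1 + δ by linarith)
  have h2 := Real.Gamma_pos_of_pos (show 0 < 1 - δ by linarith)
  unfold interferenceRate
  positivity

namespace IsTypicalRayleighLink

variable {Ω : Type*} [MeasurableSpace Ω] {P : Measure Ω}
  {lam mu p al θ δ : ℝ} {X : ℕ → Ω → Plane} {R h : Ω → ℝ} {A : ℕ → Ω → Bool} {H : ℕ → Ω → ℝ}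

lemma exists_scale (hnet : IsTypicalRayleighLink P lam mu p X R h A H) (hmu : 0 < mu) :
    ∃ s : ℝ, 0 < s ∧ HasLaw R (rayleighMeasure s) P ∧ (2 * s ^ 2)⁻¹ = Real.pi * mu := by
  obtain ⟨s, hs, hR⟩ := hnet.linkDistance_law
  refine ⟨s, hs, hR, inv_two_mul_sq_of_mean hs hmu ?_⟩
  rw [← hnet.linkDistance_mean, ← hR.map_eq,
    integral_map (f := fun r : ℝ => r) hR.aemeasurable measurable_id.aestronglyMeasurable]

/-- The exponential moments of the total loss at a deterministic link distance `r`. -/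
lemma moment_totalLoss_const (hnet : IsTypicalRayleighLink P lam mu p X R h A H) (hlam : 0 < lam)
    (hp : 0 < p) (hp1 : p ≤ 1) (hal : 2 < al) (hθ : 0 < θ) (hδ : δ = 2 / al)
    {b : ℂ} (hb : p < 1 ∨ 0 < b.re + δ) {r : ℝ} (hr : 0 < r) :
    (∀ᵐ ω ∂P, totalLoss al p θ X (fun _ => r) ω ≠ ∞) ∧
      Integrable (fun ω => Complex.exp (-b * (totalLoss al p θ X (fun _ => r) ω).toReal)) P ∧
      ∫ ω, Complex.exp (-b * (totalLoss al p θ X (fun _ => r) ω).toReal) ∂P =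
        Complex.exp (-((Real.pi * interferenceRate lam θ δ : ℝ) * diversity b p δ) *
          (r : ℂ) ^ 2) := by
  have hal0 : 0 < al := by linarith
  have hδ0 : 0 < δ := hδ ▸ by positivity
  have hs : 0 < θ * r ^ al := by positivity
  set w := interfererLoss al p (θ * r ^ al) with hw
  have hwm : Measurable w := measurable_interfererLoss _ _ _
  have hwtop : ∀ x, w x ≠ ∞ := interfererLoss_ne_top _ _ _
  -- an exponent that dominates `-Re b` and is admissible whenever `b` is
  set c : ℝ := max (-b.re) (δ / 2) with hc
  have hc0 : 0 < c := (by positivity : 0 < δ / 2).trans_le (le_max_right _ _)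
  have hcb : p < 1 ∨ 0 < (-(c : ℂ)).re + δ := by
    refine hb.imp_right fun h => ?_
    have : c < δ := max_lt (by linarith) (by linarith)
    simpa using this
  have hint1 : Integrable (fun x => Real.exp (c * (w x).toReal) - 1) := by
    have h1 := (integrable_and_integral_cexp_interfererLoss hp hp1 hal hs hδ hcb).1.re
    refine h1.congr (Eventually.of_forall fun x => ?_)
    simp only [neg_neg, RCLike.re_to_complex, ← hw]
    rw [← Complex.ofReal_mul, ← Complex.ofReal_exp, ← Complex.ofReal_one, ← Complex.ofReal_sub,
      Complex.ofReal_re]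
  have hint : Integrable (fun x => Real.exp (c * (w x).toReal) - 1)
      (ENNReal.ofReal lam • (volume : Measure Plane)) := hint1.smul_measure ENNReal.ofReal_ne_top
  have hσ : SigmaFinite (ENNReal.ofReal lam • (volume : Measure Plane)) :=
    inferInstanceAs (SigmaFinite (Real.toNNReal lam • (volume : Measure Plane)))
  have hW : ∀ ω, ∫⁻ x, w x ∂(pointProcess X ω) = totalLoss al p θ X (fun _ => r) ω :=
    fun ω => lintegral_pointProcess hwm ω
  obtain ⟨h1, h2⟩ := hnet.poisson.ae_lintegral_ne_top_and_integrable_exp hwm hwtop hc0 hint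
  have h3 := hnet.poisson.integral_cexp_lintegral hwm hwtop hc0 hint (z := -b)
    (by simp [hc])
  simp_rw [hW] at h1 h2 h3
  refine ⟨h1, ?_, ?_⟩
  · refine h2.mono' ?_ (Eventually.of_forall fun ω => ?_)
    · have := measurable_totalLoss al p θ hnet.measurable_location (measurable_const (a := r))
      exact Measurable.aestronglyMeasurable (by fun_prop)
    · rw [Complex.norm_exp, Complex.re_mul_ofReal, Complex.neg_re]
      have : -b.re ≤ c := le_max_left _ _
      gcongr
  · have hrpow : (θ * r ^ al) ^ δ = θ ^ δ * r ^ 2 := by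
      rw [Real.mul_rpow hθ.le (by positivity), ← Real.rpow_mul hr.le, hδ,
        mul_div_cancel₀ _ hal0.ne', Real.rpow_two]
    rw [h3, integral_smul_measure, ENNReal.toReal_ofReal hlam.le, hw,
      (integrable_and_integral_cexp_interfererLoss hp hp1 hal hs hδ hb).2, Complex.real_smul, hrpow,
      interferenceRate]
    congr 1
    push_cast
    ring

/-- Real exponential moments of the total loss at a deterministic link distance `r`. -/
lemma integral_norm_moment_const (hnet : IsTypicalRayleighLink P lam mu p X R h A H)
    (hlam : 0 < lam) (hp : 0 < p) (hp1 : p ≤ 1) (hal : 2 < al) (hθ : 0 < θ) (hδ : δ = 2 / al)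
    {b : ℂ} (hb : p < 1 ∨ 0 < b.re + δ) {r : ℝ} (hr : 0 < r) :
    ∫ ω, ‖Complex.exp (-b * (totalLoss al p θ X (fun _ => r) ω).toReal)‖ ∂P =
      Real.exp (-(Real.pi * interferenceRate lam θ δ * (diversity (b.re : ℂ) p δ).re) * r ^ 2) := by
  have h1 := (hnet.moment_totalLoss_const hlam hp hp1 hal hθ hδ (b := (b.re : ℂ))
    (by simpa using hb) hr).2.2
  have h2 : ∀ ω, Complex.exp (-(b.re : ℂ) * (totalLoss al p θ X (fun _ => r) ω).toReal) =
      ((‖Complex.exp (-b * (totalLoss al p θ X (fun _ => r) ω).toReal)‖ : ℝ) : ℂ) := by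
    intro ω
    rw [Complex.norm_exp, Complex.re_mul_ofReal, Complex.neg_re]
    push_cast
    rfl
  simp_rw [h2] at h1
  rw [integral_complex_ofReal] at h1
  have h3 := congrArg (fun z : ℂ => ‖z‖) h1
  simp only [Complex.norm_real] at h3
  rw [Real.norm_of_nonneg (integral_nonneg fun ω => norm_nonneg _), Complex.norm_exp] at h3
  rw [h3, ← Complex.ofReal_pow, Complex.re_mul_ofReal, Complex.neg_re, Complex.re_ofReal_mul]

/-- The real part of `D_b` dominates `D_{Re b}`: compare a moment with its absolute moment. -/
lemma re_diversity_ge (hnet : IsTypicalRayleighLink P lam mu p X R h A H)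
    (hlam : 0 < lam) (hp : 0 < p) (hp1 : p ≤ 1) (hal : 2 < al) (hθ : 0 < θ) (hδ : δ = 2 / al)
    {b : ℂ} (hb : p < 1 ∨ 0 < b.re + δ) : (diversity (b.re : ℂ) p δ).re ≤ (diversity b p δ).re := by
  have hδ0 : 0 < δ := hδ ▸ by positivity
  have hδ1 : δ < 1 := by rw [hδ, div_lt_one (by linarith)]; exact hal
  have hκ : 0 < Real.pi * interferenceRate lam θ δ :=
    mul_pos Real.pi_pos (interferenceRate_pos hlam hθ hδ0 hδ1)
  have h1 := (hnet.moment_totalLoss_const hlam hp hp1 hal hθ hδ hb one_pos).2.2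
  have h2 := hnet.integral_norm_moment_const hlam hp hp1 hal hθ hδ hb one_pos
  have h3 := norm_integral_le_integral_norm (μ := P)
    (fun ω => Complex.exp (-b * (totalLoss al p θ X (fun _ => (1 : ℝ)) ω).toReal))
  rw [h1, h2, Complex.norm_exp, Real.exp_le_exp, Complex.ofReal_one, one_pow, mul_one, one_pow,
    mul_one, Complex.neg_re, Complex.re_ofReal_mul, neg_le_neg_iff] at h3
  exact le_of_mul_le_mul_left h3 hκ

variable [IsProbabilityMeasure P]

/-- Bounded moments: `D_b` is nonnegative for real `b ≥ 0`. -/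
lemma re_diversity_re_nonneg (hnet : IsTypicalRayleighLink P lam mu p X R h A H)
    (hlam : 0 < lam) (hp : 0 < p) (hp1 : p ≤ 1) (hal : 2 < al) (hθ : 0 < θ) (hδ : δ = 2 / al)
    {b : ℂ} (hb : 0 ≤ b.re) : 0 ≤ (diversity (b.re : ℂ) p δ).re := by
  have hδ0 : 0 < δ := hδ ▸ by positivity
  have hδ1 : δ < 1 := by rw [hδ, div_lt_one (by linarith)]; exact hal
  have hκ : 0 < Real.pi * interferenceRate lam θ δ :=
    mul_pos Real.pi_pos (interferenceRate_pos hlam hθ hδ0 hδ1)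
  have h2 := hnet.integral_norm_moment_const hlam hp hp1 hal hθ hδ (b := b)
    (Or.inr (by linarith)) one_pos
  have h3 : ∫ ω, ‖Complex.exp (-b * (totalLoss al p θ X (fun _ => (1 : ℝ)) ω).toReal)‖ ∂P ≤
      ∫ _, (1 : ℝ) ∂P := by
    refine integral_mono_of_nonneg (Eventually.of_forall fun ω => norm_nonneg _)
      (integrable_const _) (Eventually.of_forall fun ω => ?_)
    simp only [Complex.norm_exp, Complex.re_mul_ofReal, Complex.neg_re, Real.exp_le_one_iff]
    exact mul_nonpos_of_nonpos_of_nonneg (by linarith) ENNReal.toReal_nonneg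
  rw [h2] at h3
  simp only [one_pow, mul_one, integral_const, probReal_univ, smul_eq_mul, Real.exp_le_one_iff,
    neg_nonpos] at h3
  exact nonneg_of_mul_nonneg_right h3 hκ

/-- The total loss as a function of the link distance and the interferer locations. -/
lemma measurable_totalLoss_canonical (al p θ : ℝ) :
    Measurable (totalLoss al p θ (fun n (q : ℝ × (ℕ → Plane)) => q.2 n) (fun q => q.1)) :=
  measurable_totalLoss al p θ (fun n => by fun_prop) (by fun_prop)

lemma map_linkDistance_locations (hnet : IsTypicalRayleighLink P lam mu p X R h A H) :
    P.map (fun ω => (R ω, fun n => X n ω)) = (P.map R).prod (P.map fun ω n => X n ω) := by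
  have hind : IndepFun R (fun ω n => X n ω) P := by
    refine hnet.indepFun_of_disjoint (S := {.linkDistance}) (T := {.locations}) (by simp) ?_ ?_
    · exact (comap_measurable R).mono
        (NetworkSource.sigma_le_iSup X R h A H (i := .linkDistance) rfl) le_rfl
    · exact (comap_measurable (fun ω n => X n ω)).mono
        (NetworkSource.sigma_le_iSup X R h A H (i := .locations) rfl) le_rfl
  exact hind.map_prod_eq_prod_map_map hnet.measurable_linkDistance.aemeasurable
    (measurable_sequence hnet.measurable_location).aemeasurable

lemma ae_totalLoss_ne_top (hnet : IsTypicalRayleighLink P lam mu p X R h A H) (hlam : 0 < lam)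
    (hp : 0 < p) (hp1 : p ≤ 1) (hal : 2 < al) (hθ : 0 < θ) :
    ∀ᵐ ω ∂P, totalLoss al p θ X R ω ≠ ∞ := by
  have hXm := measurable_sequence hnet.measurable_location
  have hL := measurable_totalLoss_canonical al p θ
  have hset : MeasurableSet {q : ℝ × (ℕ → Plane) |
      totalLoss al p θ (fun n (q : ℝ × (ℕ → Plane)) => q.2 n) (fun q => q.1) q ≠ ∞} :=
    hL (measurableSet_singleton _).compl
  refine ae_of_ae_map (f := fun ω => (R ω, fun n => X n ω))
    (hnet.measurable_linkDistance.prodMk hXm).aemeasurable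
    (p := fun q => totalLoss al p θ (fun n (q : ℝ × (ℕ → Plane)) => q.2 n) (fun q => q.1) q ≠ ∞) ?_
  have : IsProbabilityMeasure (P.map fun ω n => X n ω) :=
    Measure.isProbabilityMeasure_map hXm.aemeasurable
  rw [hnet.map_linkDistance_locations, Measure.ae_prod_iff_ae_ae hset]
  obtain ⟨s, hs, hR⟩ := hnet.linkDistance_law
  rw [hR.map_eq]
  filter_upwards [ae_rayleighMeasure_pos s] with r hr
  have h1 := (hnet.moment_totalLoss_const hlam hp hp1 hal hθ rfl (b := 0)
    (Or.inr (by simp; positivity)) hr).1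
  exact (ae_map_iff hXm.aemeasurable (measurable_prodMk_left hset)).2 h1

/-- The exponential moments of the total loss at a Rayleigh distributed link distance. -/
theorem moment_totalLoss (hnet : IsTypicalRayleighLink P lam mu p X R h A H) (hlam : 0 < lam)
    (hmu : 0 < mu) (hp : 0 < p) (hp1 : p ≤ 1) (hal : 2 < al) (hθ : 0 < θ) (hδ : δ = 2 / al)
    {b : ℂ} (hb : p < 1 ∨ 0 < b.re + δ) :
    (Integrable (fun ω => Complex.exp (-b * (totalLoss al p θ X R ω).toReal)) P ↔
      0 < mu + interferenceRate lam θ δ * (diversity (b.re : ℂ) p δ).re) ∧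
    (Integrable (fun ω => Complex.exp (-b * (totalLoss al p θ X R ω).toReal)) P →
      (mu : ℂ) + (interferenceRate lam θ δ : ℂ) * diversity b p δ ≠ 0 ∧
      ∫ ω, Complex.exp (-b * (totalLoss al p θ X R ω).toReal) ∂P =
        (mu : ℂ) / ((mu : ℂ) + (interferenceRate lam θ δ : ℂ) * diversity b p δ)) := by
  have hδ0 : 0 < δ := hδ ▸ by positivity
  have hδ1 : δ < 1 := by rw [hδ, div_lt_one (by linarith)]; exact hal
  have hκ := interferenceRate_pos hlam hθ hδ0 hδ1
  set κ := interferenceRate lam θ δ with hκ_def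
  obtain ⟨s, hs, hR, hsmu⟩ := hnet.exists_scale hmu
  have hXm := measurable_sequence hnet.measurable_location
  have hUm : Measurable (fun ω => (R ω, fun n => X n ω)) := hnet.measurable_linkDistance.prodMk hXm
  have : IsProbabilityMeasure (P.map fun ω n => X n ω) :=
    Measure.isProbabilityMeasure_map hXm.aemeasurable
  have : IsProbabilityMeasure (rayleighMeasure s) := hR.map_eq ▸
    Measure.isProbabilityMeasure_map hnet.measurable_linkDistance.aemeasurable
  let F : ℝ × (ℕ → Plane) → ℂ := fun q => Complex.exp
    (-b * (totalLoss al p θ (fun n (q : ℝ × (ℕ → Plane)) => q.2 n) (fun q => q.1) q).toReal)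
  have hF : Measurable F := by
    have := measurable_totalLoss_canonical al p θ
    fun_prop
  have hmap : P.map (fun ω => (R ω, fun n => X n ω)) =
      (rayleighMeasure s).prod (P.map fun ω n => X n ω) := by
    rw [hnet.map_linkDistance_locations, hR.map_eq]
  have hsec : ∀ r, ∀ ω, F (r, fun n => X n ω) =
    Complex.exp (-b * (totalLoss al p θ X (fun _ => r) ω).toReal) := fun r ω => rfl
  have hiff0 : Integrable (fun ω => Complex.exp (-b * (totalLoss al p θ X R ω).toReal)) P ↔
      Integrable F ((rayleighMeasure s).prod (P.map fun ω n => X n ω)) := by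
    rw [← hmap, integrable_map_measure hF.aestronglyMeasurable hUm.aemeasurable]
    rfl
  have hsecm : ∀ r, Measurable fun x => F (r, x) := fun r => hF.comp measurable_prodMk_left
  have hseci : ∀ᵐ r ∂(rayleighMeasure s), Integrable (fun x => F (r, x))
      (P.map fun ω n => X n ω) := by
    filter_upwards [ae_rayleighMeasure_pos s] with r hr
    rw [integrable_map_measure (hsecm r).aestronglyMeasurable hXm.aemeasurable]
    exact (hnet.moment_totalLoss_const hlam hp hp1 hal hθ hδ hb hr).2.1
  have hnorm : (fun r => ∫ x, ‖F (r, x)‖ ∂(P.map fun ω n => X n ω)) =ᵐ[rayleighMeasure s]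
      fun r => Real.exp (-(Real.pi * κ * (diversity (b.re : ℂ) p δ).re) * r ^ 2) := by
    filter_upwards [ae_rayleighMeasure_pos s] with r hr
    rw [integral_map hXm.aemeasurable (hsecm r).norm.aestronglyMeasurable]
    exact hnet.integral_norm_moment_const hlam hp hp1 hal hθ hδ hb hr
  have hiff : Integrable (fun ω => Complex.exp (-b * (totalLoss al p θ X R ω).toReal)) P ↔
      0 < mu + κ * (diversity (b.re : ℂ) p δ).re := by
    rw [hiff0, integrable_prod_iff hF.aestronglyMeasurable, and_iff_right hseci,
      integrable_congr hnorm, integrable_exp_neg_mul_sq_rayleighMeasure_iff hs, hsmu,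
      mul_assoc, ← mul_add]
    exact mul_pos_iff_of_pos_left Real.pi_pos
  refine ⟨hiff, fun hint => ?_⟩
  have hpos := hiff.1 hint
  have hre : 0 < mu + κ * (diversity b p δ).re := hpos.trans_le (by
    have := hnet.re_diversity_ge hlam hp hp1 hal hθ hδ hb
    gcongr)
  have hne : (mu : ℂ) + (κ : ℂ) * diversity b p δ ≠ 0 := by
    intro h0
    have h1 := congrArg Complex.re h0
    rw [Complex.add_re, Complex.re_ofReal_mul, Complex.ofReal_re, Complex.zero_re] at h1
    linarith
  refine ⟨hne, ?_⟩
  have h1 : ∫ ω, Complex.exp (-b * (totalLoss al p θ X R ω).toReal) ∂P =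
      ∫ q, F q ∂((rayleighMeasure s).prod (P.map fun ω n => X n ω)) := by
    rw [← hmap, integral_map hUm.aemeasurable hF.aestronglyMeasurable]
    rfl
  have h2 : (fun r => ∫ x, F (r, x) ∂(P.map fun ω n => X n ω)) =ᵐ[rayleighMeasure s]
      fun r => Complex.exp (-((Real.pi * κ : ℝ) * diversity b p δ) * (r : ℂ) ^ 2) := by
    filter_upwards [ae_rayleighMeasure_pos s] with r hr
    rw [integral_map hXm.aemeasurable (hsecm r).aestronglyMeasurable]
    exact (hnet.moment_totalLoss_const hlam hp hp1 hal hθ hδ hb hr).2.2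
  have hz : 0 < (2 * s ^ 2)⁻¹ + ((Real.pi * κ : ℝ) * diversity b p δ : ℂ).re := by
    rw [Complex.re_ofReal_mul, hsmu, mul_assoc, ← mul_add]
    exact mul_pos Real.pi_pos hre
  have hπ : (Real.pi : ℂ) ≠ 0 := by exact_mod_cast Real.pi_ne_zero
  rw [h1, integral_prod _ (hiff0.1 hint), integral_congr_ae h2,
    integral_cexp_neg_mul_sq_rayleighMeasure hs hz, hsmu]
  push_cast
  rw [mul_assoc, ← mul_add, mul_div_mul_left _ _ hπ]

/-- Complex powers of the conditional success probability. -/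
lemma linkSuccessProb_cpow_ae_eq (hnet : IsTypicalRayleighLink P lam mu p X R h A H)
    (hlam : 0 < lam) (hp : 0 < p) (hp1 : p ≤ 1) (hal : 2 < al) (hθ : 0 < θ) (b : ℂ) :
    (fun ω => (linkSuccessProb P al θ X R h A H ω : ℂ) ^ b) =ᵐ[P]
      fun ω => Complex.exp (-b * (totalLoss al p θ X R ω).toReal) := by
  filter_upwards [hnet.linkSuccessProb_ae_eq hp hp1 (by linarith : al ≠ 0) hθ,
    hnet.ae_totalLoss_ne_top hlam hp hp1 hal hθ] with ω h1 h2
  rw [h1, expNeg_of_ne_top h2, ENNReal.toReal_ofReal (Real.exp_pos _).le,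
    Complex.cpow_def_of_ne_zero (by exact_mod_cast (Real.exp_pos _).ne'),
    ← Complex.ofReal_log (Real.exp_pos _).le, Real.log_exp]
  congr 1
  push_cast
  ring

end IsTypicalRayleighLink

end

theorem mainTheorem6 {Ω : Type*} [MeasurableSpace Ω] (P : Measure Ω) [IsProbabilityMeasure P]
    (lam mu p al θ δ : ℝ) (hlam : 0 < lam) (hmu : 0 < mu) (hp : 0 < p) (hp1 : p ≤ 1)
    (hal : 2 < al) (hθ : 0 < θ) (hδ : δ = 2 / al)
    (X : ℕ → Ω → Plane) (R h : Ω → ℝ) (A : ℕ → Ω → Bool) (H : ℕ → Ω → ℝ)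
    (hnet : IsTypicalRayleighLink P lam mu p X R h A H)
    (b : ℂ) (hb : p < 1 ∨ 0 < b.re + δ) :
    -- the series that define `D_b` and `D_{Re b}` converge
    Summable (diversityTerm b p δ) ∧ Summable (diversityTerm (b.re : ℂ) p δ) ∧
    -- the range of `b` for which the `b`-th moment exists
    (Integrable (fun ω => (linkSuccessProb P al θ X R h A H ω : ℂ) ^ b) P ↔
      0 < mu + lam * θ ^ δ * Real.Gamma (1 + δ) * Real.Gamma (1 - δ) *
        (diversity (b.re : ℂ) p δ).re) ∧
    (0 ≤ b.re → Integrable (fun ω => (linkSuccessProb P al θ X R h A H ω : ℂ) ^ b) P) ∧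
    -- the value of the `b`-th moment
    (Integrable (fun ω => (linkSuccessProb P al θ X R h A H ω : ℂ) ^ b) P →
      (mu : ℂ) + ((lam * θ ^ δ * Real.Gamma (1 + δ) * Real.Gamma (1 - δ) : ℝ) : ℂ) *
        diversity b p δ ≠ 0 ∧
      ∫ ω, (linkSuccessProb P al θ X R h A H ω : ℂ) ^ b ∂P =
        (mu : ℂ) / ((mu : ℂ) +
          ((lam * θ ^ δ * Real.Gamma (1 + δ) * Real.Gamma (1 - δ) : ℝ) : ℂ) *
            diversity b p δ)) := by
  have hδ0 : 0 < δ := hδ ▸ by positivity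
  have hδ1 : δ < 1 := by rw [hδ, div_lt_one (by linarith)]; exact hal
  have hκ := interferenceRate_pos hlam hθ hδ0 hδ1
  have hpow := hnet.linkSuccessProb_cpow_ae_eq hlam hp hp1 hal hθ b
  obtain ⟨h1, h2⟩ := hnet.moment_totalLoss hlam hmu hp hp1 hal hθ hδ hb
  rw [integrable_congr hpow, integral_congr_ae hpow]
  refine ⟨summable_diversityTerm hp hp1 hδ0 hb,
    summable_diversityTerm hp hp1 hδ0 (by simpa using hb), h1, fun hb0 => h1.2 ?_, h2⟩
  have h3 := hnet.re_diversity_re_nonneg hlam hp hp1 hal hθ hδ hb0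
  have h4 := mul_nonneg hκ.le h3
  linarith
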